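/- **Language and algebras.** Let $\mathcal F,\mathcal G$ be disjoint sets of connectives; each connective $h$ has an arity $n_h\ge 0$ and an order type $\varepsilon_h\in\{1,\partial\}^{n_h}$. The $\mathcal L_{\mathrm{LE}}$-terms are built from countably many proposition letters, $\bot,\top,\wedge,\vee$ and the connectives in $\mathcal F\cup\mathcal G$. An $\mathcal L_{\mathrm{LE}}$-algebra (LE) $\mathbb A$ is a bounded lattice with an $n_h$-ary operation for each connective $h$, such that each $f\in\mathcal F$ preserves finite (also empty) joins in each coordinate $i$ with $\varepsilon_f(i)=1$ and turns finite meets into joins in each coordinate with $\varepsilon_f(i)=\partial$, and each $g\in\mathcal G$ preserves finite meets in each coordinate with $\varepsilon_g(i)=1$ and turns finite joins into meets in each coordinate with $\varepsilon_g(i)=\partial$. An inequality $\phi\le\psi$ is valid in $\mathbb A$ if $v(\phi)\le v(\psi)$ for all assignments $v$ of elements of $\mathbb A$ to the proposition letters. **Canonical extensions.** A canonical extension of a bounded lattice $A$ is a complete lattice $C$ containing $A$ as a bounded sublattice such that every element of $C$ is both a join of meets and a meet of joins of subsets of $A$ (denseness), and whenever $S,T\subseteq A$ satisfy $\bigwedge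 S\le\bigvee T$ in $C$ there are finite $S'\subseteq S$, $T'\subseteq T$ with $\bigwedge S'\le\bigvee T'$ (compactness). Let $K$ (closed elements) and $O$ (open elements) be the sets of meets, resp. joins, in $C$ of subsets of $A$; for an order type $\varepsilon$, $\le^\varepsilon$ is the coordinatewise order reversed where $\varepsilon_i=\partial$, $K^\varepsilon$ is the set of tuples with coordinates in $K$ where $\varepsilon_i=1$ and in $O$ where $\varepsilon_i=\partial$, and $O^\varepsilon$ is defined with $K$ and $O$ interchanged. The canonical extension $\mathbb A^\delta$ of an LE $\mathbb A$ with lattice $A$ is $C$ with the operations, for $f\in\mathcal F$ and $g\in\mathcal G$, $$f^\sigma(\bar u)=\bigvee\Big\{\bigwedge\{f(\bar a):\bar a\in A^{n_f},\ \bar k\le^{\varepsilon_f}\bar a\}: \bar k\in K^{\varepsilon_f},\ \bar k\le^{\varepsilon_f}\bar u\Big\},$$ $$g^\pi(\bar u)=\bigwedge\Big\{\bigvee\{g(\bar a):\bar a\in A^{n_g},\ \bar a\le^{\varepsilon_g}\bar o\}: \bar o\in O^{\varepsilon_g},\ \bar u\le^{\varepsilon_g}\bar o\Big\}.$$ **Signs.**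 The signed generation tree $+s$ (resp. $-s$) of a term gives the root the sign $+$ (resp. $-$); a child has the sign of its parent, except that it has the opposite sign if it is in a coordinate of order type $\partial$ of a connective. A term is positive (negative) in an atom $p$ if all occurrences of $p$ in $+s$ have the sign $+$ ($-$). A node is *SLR* if it is $+f$ or $-g$ with $f\in\mathcal F$, $g\in\mathcal G$ of arity at least $1$. In an inequality $s\le t$ the trees $+s$ and $-t$ are considered. **Expanded language.** $\mathcal L^+_{\mathrm{LE}}$ has as further atoms nominals $\mathbf j_0,\mathbf j_1,\dots$ and co-nominals $\mathbf m_0,\mathbf m_1,\dots$, and as further connectives $f^\sharp_i$ ($f\in\mathcal F$, $1\le i\le n_f$; in $\mathcal G^*$ if $\varepsilon_f(i)=1$, in $\mathcal F^*$ if $\varepsilon_f(i)=\partial$) and $g^\flat_i$ ($g\in\mathcal G$, $1\le i\le n_g$; in $\mathcal F^*$ if $\varepsilon_g(i)=1$, in $\mathcal G^*$ if $\varepsilon_g(i)=\partial$). For $h^\star_i\in\{f^\sharp_i,g^\flat_i\}$ the arity is $n_h$ and the order type is: $1$ at $i$ and opposite to $\varepsilon_h$ elsewhere if $\varepsilon_h(i)=1$;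 equal to $\varepsilon_h$ if $\varepsilon_h(i)=\partial$. Signs are defined in the same way. An expression is pure if no proposition letter occurs in it. **ALBA.** *Stage 1* transforms $\phi\le\psi$, in this order, by exhaustive application of: (1) elimination of a letter $p$ occurring in $\alpha\le\beta$: $p$ is replaced by $\bot$ if $\alpha$ is negative and $\beta$ positive in $p$, and by $\top$ if $\alpha$ is positive and $\beta$ negative in $p$; (2) distribution, at any node, of $+f$ over a child $+\vee$ or $-\wedge$ (giving a join of two $f$-terms) and of $-g$ over a child $-\wedge$ or $+\vee$ (giving a meet of two $g$-terms); (3) splitting: $\alpha\le\beta\wedge\gamma$ is replaced by $\alpha\le\beta$ and $\alpha\le\gamma$, and $\alpha\vee\beta\le\gamma$ by $\alpha\le\gamma$ and $\beta\le\gamma$. Each resulting inequality $\phi'\le\psi'$ gives an initial system $(\varnothing,\phi'\le\psi')$. *Stage 2* transforms systems $(S,\mathsf{Ineq})$, with $S$ a finite set of $\mathcal L^+_{\mathrm{LE}}$-inequalities and $\mathsf{Ineq}$ an $\mathcal L^+_{\mathrm{LE}}$-inequality, by the following rules. - *Approximation.* If $\mathsf{Ineq}$ is $\phi'(\gamma/!x)\le\psi$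 or $\phi\le\psi'(\gamma/!x)$, where $x$ occurs exactly once in $\phi'$ resp. $\psi'$, all nodes above $x$ in $+\phi'$ resp. $-\psi'$ are SLR nodes, and $\gamma$ is an $\mathcal L_{\mathrm{LE}}$-term: if $x$ has the sign $+$ in that tree, replace this occurrence of $\gamma$ in $\mathsf{Ineq}$ by the first nominal $\mathbf j$ not occurring in the system and add $\mathbf j\le\gamma$ to $S$; if $x$ has the sign $-$, replace it by the first co-nominal $\mathbf m$ not occurring in the system and add $\gamma\le\mathbf m$ to $S$. The application is *pivotal* if the SLR branch is maximal, i.e. the root of $\gamma$, with the sign of $x$, is not an SLR node. - *Residuation*, rewriting a member of $S$: $f(\bar\phi)\le\psi$ becomes $\phi_i\le f^\sharp_i(\bar\phi[\psi/\phi_i])$ if $\varepsilon_f(i)=1$, and $f^\sharp_i(\bar\phi[\psi/\phi_i])\le\phi_i$ if $\varepsilon_f(i)=\partial$; $\psi\le g(\bar\phi)$ becomes $g^\flat_i(\bar\phi[\psi/\phi_i])\le\phi_i$ if $\varepsilon_g(i)=1$, and $\phi_i\le g^\flat_i(\bar\phi[\psi/\phi_i])$ if $\varepsilon_g(i)=\partial$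 (here $\bar\phi[\psi/\phi_i]$ is $\bar\phi$ with $\psi$ in the $i$th place). - *Splitting* of a member of $S$. - *Ackermann.* If $S=\{\alpha_i\le p\mid 1\le i\le n\}\cup\{\beta_j\le\gamma_j\mid 1\le j\le m\}$ with $n,m\ge0$, $p$ does not occur in $\alpha_1,\dots,\alpha_n,\mathsf{Ineq}$, all $\beta_j$ are positive and all $\gamma_j$ negative in $p$, then replace $S$ by $\{\beta_j(\alpha/p)\le\gamma_j(\alpha/p)\mid 1\le j\le m\}$ with $\alpha=\bigvee_{i=1}^n\alpha_i$. Dually, if $S=\{p\le\alpha_i\mid 1\le i\le n\}\cup\{\beta_j\le\gamma_j\mid 1\le j\le m\}$, $p$ does not occur in $\alpha_1,\dots,\alpha_n,\mathsf{Ineq}$, all $\beta_j$ are negative and all $\gamma_j$ positive in $p$, do the same with $\alpha=\bigwedge_{i=1}^n\alpha_i$. ALBA *succeeds pivotally* on $\phi\le\psi$ if some execution, in which all applications of approximation rules are pivotal, transforms every initial system into a pure system. **Theorem.** Every $\mathcal L_{\mathrm{LE}}$-inequality $\phi\le\psi$ on which ALBA succeeds pivotally is canonical: for every $\mathcal L_{\mathrm{LE}}$-algebra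 $\mathbb A$, if $\phi\le\psi$ is valid in $\mathbb A$, then it is valid in the canonical extension $\mathbb A^\delta$. -/

import Mathlib

universe u v w

namespace LatExp

/-! ### Languages and terms -/

/-- The two values `1`, `∂` of an order type, and also the two signs `+`, `-` of the nodes of a
signed generation tree: `pos` is `1` or `+`, and `neg` is `∂` or `-`. -/
inductive Pol : Type
  | pos
  | neg

/-- The opposite value. -/
def Pol.op : Pol → Pol
  | .pos => .neg
  | .neg => .pos

/-- `s.through ε` is the sign of a child node sitting in a coordinate of order type `ε` of a node
with sign `s`: the same sign if `ε = 1`, the opposite sign if `ε = ∂`. -/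
def Pol.through (s : Pol) : Pol → Pol
  | .pos => s
  | .neg => s.op

/-- The parameters `(F, G)` of a language of lattice expansions: two (disjoint) families of
connectives, each connective having an arity and an order type over its arity. -/
structure Signature : Type (u + 1) where
  F : Type u
  G : Type u
  arF : F → ℕ
  arG : G → ℕ
  epsF : (f : F) → Fin (arF f) → Pol
  epsG : (g : G) → Fin (arG g) → Pol

/-- Terms over the signature `L` with atoms from `V`. -/
inductive Term (L : Signature.{u}) (V : Type) : Type u
  | atom (x : V) : Term L V
  | bot : Term L V
  | top : Term L V
  | meet (s t : Term L V) : Term L V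
  | join (s t : Term L V) : Term L V
  | opF (f : L.F) (args : Fin (L.arF f) → Term L V) : Term L V
  | opG (g : L.G) (args : Fin (L.arG g) → Term L V) : Term L V

/-- Inequalities `lhs ≤ rhs` between terms. -/
@[ext]
structure Ineq (L : Signature.{u}) (V : Type) : Type u where
  lhs : Term L V
  rhs : Term L V

noncomputable instance (L : Signature.{u}) (V : Type) : DecidableEq (Ineq L V) :=
  Classical.decEq _

namespace Term

variable {L : Signature.{u}} {V : Type}

/-- The atom `x` occurs in the term. -/
def Occurs (x : V) : Term L V → Prop
  | atom y => y = x
  | bot => False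
  | top => False
  | meet s t => s.Occurs x ∨ t.Occurs x
  | join s t => s.Occurs x ∨ t.Occurs x
  | opF _ a => ∃ i, (a i).Occurs x
  | opG _ a => ∃ i, (a i).Occurs x

/-- `OccursWith x σ s t`: some leaf labelled `x` has the sign `σ` in the generation tree of `t`
whose root has the sign `s`. -/
def OccursWith (x : V) (σ : Pol) : Pol → Term L V → Prop
  | s, atom y => y = x ∧ s = σ
  | _, bot => False
  | _, top => False
  | s, meet t t' => t.OccursWith x σ s ∨ t'.OccursWith x σ s
  | s, join t t' => t.OccursWith x σ s ∨ t'.OccursWith x σ s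
  | s, opF f a => ∃ i, (a i).OccursWith x σ (s.through (L.epsF f i))
  | s, opG g a => ∃ i, (a i).OccursWith x σ (s.through (L.epsG g i))

/-- The term is positive in `x`: every occurrence of `x` in its positive generation tree is
positive. -/
def PositiveIn (x : V) (t : Term L V) : Prop := ¬ t.OccursWith x .neg .pos

/-- The term is negative in `x`: every occurrence of `x` in its positive generation tree is
negative. -/
def NegativeIn (x : V) (t : Term L V) : Prop := ¬ t.OccursWith x .pos .pos

/-- `Term.subst x r t` is `t(r/x)`. -/
def subst [DecidableEq V] (x : V) (r : Term L V) : Term L V → Term L V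
  | atom y => if y = x then r else atom y
  | bot => bot
  | top => top
  | meet s t => meet (subst x r s) (subst x r t)
  | join s t => join (subst x r s) (subst x r t)
  | opF f a => opF f fun i => subst x r (a i)
  | opG g a => opG g fun i => subst x r (a i)

/-- The finite join of a list of terms; it is `⊥` for the empty list. -/
def bigJoin : List (Term L V) → Term L V
  | [] => bot
  | [a] => a
  | a :: b :: l => join a (bigJoin (b :: l))

/-- The finite meet of a list of terms; it is `⊤` for the empty list. -/
def bigMeet : List (Term L V) → Term L V
  | [] => top
  | [a] => a
  | a :: b :: l => meet a (bigMeet (b :: l))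

/-- With the sign `s` at the root of the term, this root is a syntactically left residual (SLR)
node: it is `+f` or `-g` for a connective `f ∈ F` or `g ∈ G` of arity at least `1`. -/
def RootSLR : Pol → Term L V → Prop
  | .pos, opF f _ => 1 ≤ L.arF f
  | .neg, opG g _ => 1 ≤ L.arG g
  | _, _ => False

end Term

/-- `i.subst x r` is the result of the substitution of `r` for `x` in both sides. -/
def Ineq.subst {L : Signature.{u}} {V : Type} [DecidableEq V] (x : V) (r : Term L V)
    (i : Ineq L V) : Ineq L V :=
  ⟨Term.subst x r i.lhs, Term.subst x r i.rhs⟩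

/-- The atom `x` occurs in the inequality. -/
def Ineq.Occurs {L : Signature.{u}} {V : Type} (x : V) (i : Ineq L V) : Prop :=
  i.lhs.Occurs x ∨ i.rhs.Occurs x

/-- Terms `φ(!x)` with exactly one occurrence of a placeholder `x`. In `opF f i args C` and
`opG g i args C` the placeholder is in the `i`-th argument, which is `C`, and the entry `args i` is
not used. -/
inductive Ctx (L : Signature.{u}) (V : Type) : Type u
  | hole : Ctx L V
  | meetL (C : Ctx L V) (t : Term L V) : Ctx L V
  | meetR (t : Term L V) (C : Ctx L V) : Ctx L V
  | joinL (C : Ctx L V) (t : Term L V) : Ctx L V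
  | joinR (t : Term L V) (C : Ctx L V) : Ctx L V
  | opF (f : L.F) (i : Fin (L.arF f)) (args : Fin (L.arF f) → Term L V) (C : Ctx L V) : Ctx L V
  | opG (g : L.G) (i : Fin (L.arG g)) (args : Fin (L.arG g) → Term L V) (C : Ctx L V) : Ctx L V

namespace Ctx

variable {L : Signature.{u}} {V : Type}

/-- `C.plug γ` is `φ(γ/!x)`. -/
def plug : Ctx L V → Term L V → Term L V
  | hole, γ => γ
  | meetL C t, γ => .meet (C.plug γ) t
  | meetR t C, γ => .meet t (C.plug γ)
  | joinL C t, γ => .join (C.plug γ) t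
  | joinR t C, γ => .join t (C.plug γ)
  | opF f i a C, γ => .opF f (Function.update a i (C.plug γ))
  | opG g i a C, γ => .opG g (Function.update a i (C.plug γ))

/-- The sign of the placeholder in the generation tree whose root has the sign `s`. -/
def sign : Pol → Ctx L V → Pol
  | s, hole => s
  | s, meetL C _ => C.sign s
  | s, meetR _ C => C.sign s
  | s, joinL C _ => C.sign s
  | s, joinR _ C => C.sign s
  | s, opF f i _ C => C.sign (s.through (L.epsF f i))
  | s, opG g i _ C => C.sign (s.through (L.epsG g i))

/-- In the generation tree whose root has the sign `s`, the branch from the placeholder to the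
root is SLR: all its nodes above the placeholder are SLR nodes, that is, they are labelled `+f`
or `-g`. -/
def SLR : Pol → Ctx L V → Prop
  | _, hole => True
  | _, meetL _ _ => False
  | _, meetR _ _ => False
  | _, joinL _ _ => False
  | _, joinR _ _ => False
  | s, opF f i _ C => s = .pos ∧ C.SLR (s.through (L.epsF f i))
  | s, opG g i _ C => s = .neg ∧ C.SLR (s.through (L.epsG g i))

end Ctx

/-! ### The expanded language -/

/-- The family `F*`: the connectives of `F`, the `f♯ᵢ` with `ε_f(i) = ∂`, and the `g♭ᵢ` with
`ε_g(i) = 1`. -/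
inductive TenseF (L : Signature.{u}) : Type u
  | base (f : L.F) : TenseF L
  | sharp (f : L.F) (i : Fin (L.arF f)) (h : L.epsF f i = .neg) : TenseF L
  | flat (g : L.G) (i : Fin (L.arG g)) (h : L.epsG g i = .pos) : TenseF L

/-- The family `G*`: the connectives of `G`, the `f♯ᵢ` with `ε_f(i) = 1`, and the `g♭ᵢ` with
`ε_g(i) = ∂`. -/
inductive TenseG (L : Signature.{u}) : Type u
  | base (g : L.G) : TenseG L
  | sharp (f : L.F) (i : Fin (L.arF f)) (h : L.epsF f i = .pos) : TenseG L
  | flat (g : L.G) (i : Fin (L.arG g)) (h : L.epsG g i = .neg) : TenseG L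

/-- The order type of the residual in the `i`-th coordinate of an operation of order type `ε`:
if `ε i = 1`, it is `1` at `i` and opposite to `ε` elsewhere; if `ε i = ∂`, it is `∂` at `i` and
agrees with `ε` elsewhere. -/
def residualType {n : ℕ} (ε : Fin n → Pol) (i : Fin n) : Fin n → Pol := fun j =>
  match ε i with
  | .pos => if j = i then .pos else (ε j).op
  | .neg => ε j

/-- The signature of the tense language `L*`. -/
abbrev Signature.tense (L : Signature.{u}) : Signature.{u} where
  F := TenseF L
  G := TenseG L
  arF
    | .base f => L.arF f
    | .sharp f _ _ => L.arF f
    | .flat g _ _ => L.arG g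
  arG
    | .base g => L.arG g
    | .sharp f _ _ => L.arF f
    | .flat g _ _ => L.arG g
  epsF
    | .base f => L.epsF f
    | .sharp f i _ => residualType (L.epsF f) i
    | .flat g i _ => residualType (L.epsG g) i
  epsG
    | .base g => L.epsG g
    | .sharp f i _ => residualType (L.epsF f) i
    | .flat g i _ => residualType (L.epsG g) i

/-- The atoms of the expanded language: proposition letters, nominals and co-nominals. -/
inductive Atom : Type
  | prop (k : ℕ)
  | nom (k : ℕ)
  | conom (k : ℕ)
  deriving DecidableEq

/-- Terms of the base language; the proposition letters are indexed by `ℕ`. -/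
abbrev BTerm (L : Signature.{u}) : Type u := Term L ℕ

/-- Terms of the expanded language `L⁺`. -/
abbrev ETerm (L : Signature.{u}) : Type u := Term L.tense Atom

/-- Inequalities of the base language. -/
abbrev BIneq (L : Signature.{u}) : Type u := Ineq L ℕ

/-- Inequalities of the expanded language. -/
abbrev EIneq (L : Signature.{u}) : Type u := Ineq L.tense Atom

/-- The inclusion of the base language in the expanded language. -/
def Term.embed {L : Signature.{u}} : BTerm L → ETerm L
  | .atom p => .atom (.prop p)
  | .bot => .bot
  | .top => .top
  | .meet s t => .meet s.embed t.embed
  | .join s t => .join s.embed t.embed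
  | .opF f a => .opF (L := L.tense) (TenseF.base f) fun i => (a i).embed
  | .opG g a => .opG (L := L.tense) (TenseG.base g) fun i => (a i).embed

/-- The inclusion of inequalities of the base language in those of the expanded language. -/
def Ineq.embed {L : Signature.{u}} (i : BIneq L) : EIneq L := ⟨i.lhs.embed, i.rhs.embed⟩

/-! ### Stage 1 of ALBA: preprocessing -/

section Preprocessing

variable {L : Signature.{u}}

/-- `b` is obtained from `a` by exhaustive application of the rules `R`. -/
def Exhaustively {α : Type*} (R : α → α → Prop) (a b : α) : Prop :=
  Relation.ReflTransGen R a b ∧ ∀ c, ¬ R b c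

/-- Elimination of one proposition letter that occurs in the inequality and is uniform in it. -/
inductive ElimStep : BIneq L → BIneq L → Prop
  | toBot (α β : BTerm L) (p : ℕ) (hp : α.Occurs p ∨ β.Occurs p)
      (hα : α.NegativeIn p) (hβ : β.PositiveIn p) :
      ElimStep ⟨α, β⟩ ⟨Term.subst p .bot α, Term.subst p .bot β⟩
  | toTop (γ δ : BTerm L) (p : ℕ) (hp : γ.Occurs p ∨ δ.Occurs p)
      (hγ : γ.PositiveIn p) (hδ : δ.NegativeIn p) :
      ElimStep ⟨γ, δ⟩ ⟨Term.subst p .top γ, Term.subst p .top δ⟩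

/-- `DistRedex s t t'`: at a node of sign `s`, the term `t` is rewritten to `t'` by distributing
`+f` over a child `+∨` or `-∧`, or `-g` over a child `-∧` or `+∨`. -/
inductive DistRedex : Pol → BTerm L → BTerm L → Prop
  | fJoin (f : L.F) (i : Fin (L.arF f)) (h : L.epsF f i = .pos) (a : Fin (L.arF f) → BTerm L)
      (x y : BTerm L) :
      DistRedex .pos (.opF f (Function.update a i (.join x y)))
        (.join (.opF f (Function.update a i x)) (.opF f (Function.update a i y)))
  | fMeet (f : L.F) (i : Fin (L.arF f)) (h : L.epsF f i = .neg) (a : Fin (L.arF f) → BTerm L)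
      (x y : BTerm L) :
      DistRedex .pos (.opF f (Function.update a i (.meet x y)))
        (.join (.opF f (Function.update a i x)) (.opF f (Function.update a i y)))
  | gMeet (g : L.G) (i : Fin (L.arG g)) (h : L.epsG g i = .pos) (a : Fin (L.arG g) → BTerm L)
      (x y : BTerm L) :
      DistRedex .neg (.opG g (Function.update a i (.meet x y)))
        (.meet (.opG g (Function.update a i x)) (.opG g (Function.update a i y)))
  | gJoin (g : L.G) (i : Fin (L.arG g)) (h : L.epsG g i = .neg) (a : Fin (L.arG g) → BTerm L)
      (x y : BTerm L) :
      DistRedex .neg (.opG g (Function.update a i (.join x y)))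
        (.meet (.opG g (Function.update a i x)) (.opG g (Function.update a i y)))

/-- One distribution step at some node of the positive generation tree of the left-hand side or of
the negative generation tree of the right-hand side. -/
inductive DistStep : BIneq L → BIneq L → Prop
  | left (C : Ctx L ℕ) (s s' t : BTerm L) (h : DistRedex (C.sign .pos) s s') :
      DistStep ⟨C.plug s, t⟩ ⟨C.plug s', t⟩
  | right (C : Ctx L ℕ) (s t t' : BTerm L) (h : DistRedex (C.sign .neg) t t') :
      DistStep ⟨s, C.plug t⟩ ⟨s, C.plug t'⟩

/-- The splitting rules: the first inequality is replaced by the two others. -/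
inductive Splits {L : Signature.{u}} {V : Type} : Ineq L V → Ineq L V → Ineq L V → Prop
  | meet (α β γ : Term L V) : Splits ⟨α, .meet β γ⟩ ⟨α, β⟩ ⟨α, γ⟩
  | join (α β γ : Term L V) : Splits ⟨.join α β, γ⟩ ⟨α, γ⟩ ⟨β, γ⟩

/-- One application of a splitting rule to a member of a finite set of inequalities. -/
inductive SplitStep {L : Signature.{u}} {V : Type} :
    Finset (Ineq L V) → Finset (Ineq L V) → Prop
  | mk (S : Finset (Ineq L V)) (i j k : Ineq L V) (hi : i ∈ S) (h : Splits i j k) :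
      SplitStep S (insert j (insert k (S.erase i)))

/-- `I` is a set of inequalities that the preprocessing produces from the inequality `i`. -/
def Preprocess (i : BIneq L) (I : Finset (BIneq L)) : Prop :=
  ∃ i₁ i₂ : BIneq L, Exhaustively ElimStep i i₁ ∧ Exhaustively DistStep i₁ i₂ ∧
    Exhaustively SplitStep {i₂} I

end Preprocessing

/-! ### Stage 2 of ALBA: reduction and elimination -/

/-- Systems `(S, Ineq)`. -/
structure System (L : Signature.{u}) : Type u where
  S : Finset (EIneq L)
  main : EIneq L

/-- The atom `x` occurs in the system. -/
def System.Occurs {L : Signature.{u}} (x : Atom) (X : System L) : Prop :=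
  (∃ i ∈ X.S, i.Occurs x) ∨ X.main.Occurs x

/-- A system is pure if no proposition letter occurs in it. -/
def System.Pure {L : Signature.{u}} (X : System L) : Prop :=
  ∀ p : ℕ, ¬ X.Occurs (.prop p)

/-- `nom j` is the first nominal that does not occur in the system. -/
def System.FirstNom {L : Signature.{u}} (X : System L) (j : ℕ) : Prop :=
  IsLeast {k : ℕ | ¬ X.Occurs (.nom k)} j

/-- `conom m` is the first co-nominal that does not occur in the system. -/
def System.FirstConom {L : Signature.{u}} (X : System L) (m : ℕ) : Prop :=
  IsLeast {k : ℕ | ¬ X.Occurs (.conom k)} m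

/-- A pivotal occurrence of the subterm `γ` in `φ(γ/!x)`, where `φ(!x)` is given by `C` and the
root has the sign `s`: the branch from `x` to the root is SLR and is maximal with this property,
that is, the root of `γ` is not an SLR node (in the sign that it inherits). -/
def Pivotal {L : Signature.{u}} {V : Type} (s : Pol) (C : Ctx L V) (γ : Term L V) : Prop :=
  C.SLR s ∧ ¬ γ.RootSLR (C.sign s)

/-- The approximation rules, restricted to pivotal applications. The term `γ` belongs to the base
language. -/
inductive PivotalApprox {L : Signature.{u}} : System L → System L → Prop
  | leftPos (S : Finset (EIneq L)) (C : Ctx L.tense Atom) (γ : BTerm L) (ψ : ETerm L) (j : ℕ)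
      (hpiv : Pivotal .pos C γ.embed) (hsign : C.sign .pos = .pos)
      (hj : System.FirstNom ⟨S, C.plug γ.embed, ψ⟩ j) :
      PivotalApprox ⟨S, C.plug γ.embed, ψ⟩
        ⟨insert ⟨.atom (.nom j), γ.embed⟩ S, C.plug (.atom (.nom j)), ψ⟩
  | leftNeg (S : Finset (EIneq L)) (C : Ctx L.tense Atom) (γ : BTerm L) (ψ : ETerm L) (m : ℕ)
      (hpiv : Pivotal .pos C γ.embed) (hsign : C.sign .pos = .neg)
      (hm : System.FirstConom ⟨S, C.plug γ.embed, ψ⟩ m) :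
      PivotalApprox ⟨S, C.plug γ.embed, ψ⟩
        ⟨insert ⟨γ.embed, .atom (.conom m)⟩ S, C.plug (.atom (.conom m)), ψ⟩
  | rightPos (S : Finset (EIneq L)) (C : Ctx L.tense Atom) (γ : BTerm L) (φ : ETerm L) (j : ℕ)
      (hpiv : Pivotal .neg C γ.embed) (hsign : C.sign .neg = .pos)
      (hj : System.FirstNom ⟨S, φ, C.plug γ.embed⟩ j) :
      PivotalApprox ⟨S, φ, C.plug γ.embed⟩
        ⟨insert ⟨.atom (.nom j), γ.embed⟩ S, φ, C.plug (.atom (.nom j))⟩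
  | rightNeg (S : Finset (EIneq L)) (C : Ctx L.tense Atom) (γ : BTerm L) (φ : ETerm L) (m : ℕ)
      (hpiv : Pivotal .neg C γ.embed) (hsign : C.sign .neg = .neg)
      (hm : System.FirstConom ⟨S, φ, C.plug γ.embed⟩ m) :
      PivotalApprox ⟨S, φ, C.plug γ.embed⟩
        ⟨insert ⟨γ.embed, .atom (.conom m)⟩ S, φ, C.plug (.atom (.conom m))⟩

/-- The residuation rules: the first inequality is rewritten to the second. -/
inductive Residuation {L : Signature.{u}} : EIneq L → EIneq L → Prop
  | fPos (f : L.F) (i : Fin (L.arF f)) (h : L.epsF f i = .pos) (φ : Fin (L.arF f) → ETerm L)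
      (ψ : ETerm L) :
      Residuation ⟨.opF (L := L.tense) (TenseF.base f) φ, ψ⟩
        ⟨φ i, .opG (L := L.tense) (TenseG.sharp f i h) (Function.update φ i ψ)⟩
  | fNeg (f : L.F) (i : Fin (L.arF f)) (h : L.epsF f i = .neg) (φ : Fin (L.arF f) → ETerm L)
      (ψ : ETerm L) :
      Residuation ⟨.opF (L := L.tense) (TenseF.base f) φ, ψ⟩
        ⟨.opF (L := L.tense) (TenseF.sharp f i h) (Function.update φ i ψ), φ i⟩
  | gPos (g : L.G) (i : Fin (L.arG g)) (h : L.epsG g i = .pos) (φ : Fin (L.arG g) → ETerm L)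
      (ψ : ETerm L) :
      Residuation ⟨ψ, .opG (L := L.tense) (TenseG.base g) φ⟩
        ⟨.opF (L := L.tense) (TenseF.flat g i h) (Function.update φ i ψ), φ i⟩
  | gNeg (g : L.G) (i : Fin (L.arG g)) (h : L.epsG g i = .neg) (φ : Fin (L.arG g) → ETerm L)
      (ψ : ETerm L) :
      Residuation ⟨ψ, .opG (L := L.tense) (TenseG.base g) φ⟩
        ⟨φ i, .opG (L := L.tense) (TenseG.flat g i h) (Function.update φ i ψ)⟩

/-- The Ackermann rules. -/
inductive Ackermann {L : Signature.{u}} : System L → System L → Prop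
  | right (p : ℕ) (αs : List (ETerm L)) (R : Finset (EIneq L)) (main : EIneq L)
      (hα : ∀ α ∈ αs, ¬ α.Occurs (.prop p)) (hmain : ¬ main.Occurs (.prop p))
      (hβ : ∀ i ∈ R, i.lhs.PositiveIn (.prop p)) (hγ : ∀ i ∈ R, i.rhs.NegativeIn (.prop p)) :
      Ackermann ⟨(αs.map fun α => (⟨α, .atom (.prop p)⟩ : EIneq L)).toFinset ∪ R, main⟩
        ⟨R.image fun i => i.subst (.prop p) (Term.bigJoin αs), main⟩
  | left (p : ℕ) (αs : List (ETerm L)) (R : Finset (EIneq L)) (main : EIneq L)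
      (hα : ∀ α ∈ αs, ¬ α.Occurs (.prop p)) (hmain : ¬ main.Occurs (.prop p))
      (hβ : ∀ i ∈ R, i.lhs.NegativeIn (.prop p)) (hγ : ∀ i ∈ R, i.rhs.PositiveIn (.prop p)) :
      Ackermann ⟨(αs.map fun α => (⟨.atom (.prop p), α⟩ : EIneq L)).toFinset ∪ R, main⟩
        ⟨R.image fun i => i.subst (.prop p) (Term.bigMeet αs), main⟩

/-- One step of a pivotal execution of the second stage of ALBA. -/
inductive PivotalStep {L : Signature.{u}} : System L → System L → Prop
  | approx (X Y : System L) (h : PivotalApprox X Y) : PivotalStep X Y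
  | residuation (S : Finset (EIneq L)) (main i j : EIneq L) (hi : i ∈ S)
      (h : Residuation i j) : PivotalStep ⟨S, main⟩ ⟨insert j (S.erase i), main⟩
  | split (S T : Finset (EIneq L)) (main : EIneq L) (h : SplitStep S T) :
      PivotalStep ⟨S, main⟩ ⟨T, main⟩
  | ackermann (X Y : System L) (h : Ackermann X Y) : PivotalStep X Y

/-- ALBA succeeds pivotally on the inequality `i`: some execution preprocesses `i` to a finite set
of inequalities and transforms each of the resulting initial systems into a pure system, all
applications of approximation rules being pivotal. -/
def ALBASucceedsPivotally {L : Signature.{u}} (i : BIneq L) : Prop :=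
  ∃ I : Finset (BIneq L), Preprocess i I ∧
    ∀ k ∈ I, ∃ Y : System L, Relation.ReflTransGen PivotalStep ⟨∅, k.embed⟩ Y ∧ Y.Pure

/-! ### Lattice expansions and canonical extensions -/

/-- An interpretation of the connectives of `L` as operations on `A`. -/
structure Ops (L : Signature.{u}) (A : Type v) where
  opF : (f : L.F) → (Fin (L.arF f) → A) → A
  opG : (g : L.G) → (Fin (L.arG g) → A) → A

/-- (Normal) lattice expansions over the bounded lattice `A`. -/
structure LatticeExpansion (L : Signature.{u}) (A : Type v) [Lattice A] [BoundedOrder A]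
    extends Ops L A where
  f_sup : ∀ f i, L.epsF f i = .pos → ∀ a x y, opF f (Function.update a i (x ⊔ y)) =
    opF f (Function.update a i x) ⊔ opF f (Function.update a i y)
  f_bot : ∀ f i, L.epsF f i = .pos → ∀ a, opF f (Function.update a i ⊥) = ⊥
  f_inf : ∀ f i, L.epsF f i = .neg → ∀ a x y, opF f (Function.update a i (x ⊓ y)) =
    opF f (Function.update a i x) ⊔ opF f (Function.update a i y)
  f_top : ∀ f i, L.epsF f i = .neg → ∀ a, opF f (Function.update a i ⊤) = ⊥
  g_inf : ∀ g i, L.epsG g i = .pos → ∀ a x y, opG g (Function.update a i (x ⊓ y)) =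
    opG g (Function.update a i x) ⊓ opG g (Function.update a i y)
  g_top : ∀ g i, L.epsG g i = .pos → ∀ a, opG g (Function.update a i ⊤) = ⊤
  g_sup : ∀ g i, L.epsG g i = .neg → ∀ a x y, opG g (Function.update a i (x ⊔ y)) =
    opG g (Function.update a i x) ⊓ opG g (Function.update a i y)
  g_bot : ∀ g i, L.epsG g i = .neg → ∀ a, opG g (Function.update a i ⊥) = ⊤

/-- The value of a term under an assignment of the atoms. -/
def Term.eval {L : Signature.{u}} {V : Type} {A : Type v} [Lattice A] [BoundedOrder A]
    (O : Ops L A) (h : V → A) : Term L V → A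
  | .atom x => h x
  | .bot => ⊥
  | .top => ⊤
  | .meet s t => s.eval O h ⊓ t.eval O h
  | .join s t => s.eval O h ⊔ t.eval O h
  | .opF f a => O.opF f fun i => (a i).eval O h
  | .opG g a => O.opG g fun i => (a i).eval O h

/-- The inequality `i` is valid in the algebra given by the operations `O`. -/
def Ops.Valid {L : Signature.{u}} {A : Type v} [Lattice A] [BoundedOrder A] (O : Ops L A)
    (i : BIneq L) : Prop :=
  ∀ h : ℕ → A, i.lhs.eval O h ≤ i.rhs.eval O h

section CanonicalExtension

variable {A : Type v} {C : Type w} [Lattice A] [BoundedOrder A] [CompleteLattice C]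

/-- The closed elements: meets of subsets of `A`. -/
def closedElts (e : BoundedLatticeHom A C) : Set C := {k | ∃ S : Set A, k = sInf (e '' S)}

/-- The open elements: joins of subsets of `A`. -/
def openElts (e : BoundedLatticeHom A C) : Set C := {o | ∃ S : Set A, o = sSup (e '' S)}

/-- The complete lattice `C` together with the embedding `e` is a canonical extension of the
bounded lattice `A`. -/
structure IsCanonicalExtension (e : BoundedLatticeHom A C) : Prop where
  injective : Function.Injective e
  join_of_meets : ∀ u : C, ∃ X : Set C, X ⊆ closedElts e ∧ u = sSup X
  meet_of_joins : ∀ u : C, ∃ X : Set C, X ⊆ openElts e ∧ u = sInf X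
  compact : ∀ S T : Set A, sInf (e '' S) ≤ sSup (e '' T) →
    ∃ S' T' : Set A, S' ⊆ S ∧ T' ⊆ T ∧ S'.Finite ∧ T'.Finite ∧ sInf (e '' S') ≤ sSup (e '' T')

/-- The product order `x ≤^ε y`: it is `x i ≤ y i` if `ε i = 1`, and `y i ≤ x i` if `ε i = ∂`. -/
def PolLE {n : ℕ} (ε : Fin n → Pol) (x y : Fin n → C) : Prop :=
  ∀ i, match ε i with
    | .pos => x i ≤ y i
    | .neg => y i ≤ x i

/-- The tuples in `K^ε`: closed where `ε i = 1`, open where `ε i = ∂`. -/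
def PolClosed (e : BoundedLatticeHom A C) {n : ℕ} (ε : Fin n → Pol) (k : Fin n → C) : Prop :=
  ∀ i, match ε i with
    | .pos => k i ∈ closedElts e
    | .neg => k i ∈ openElts e

/-- The tuples in `O^ε`: open where `ε i = 1`, closed where `ε i = ∂`. -/
def PolOpen (e : BoundedLatticeHom A C) {n : ℕ} (ε : Fin n → Pol) (o : Fin n → C) : Prop :=
  ∀ i, match ε i with
    | .pos => o i ∈ openElts e
    | .neg => o i ∈ closedElts e

/-- The `σ`-extension of an `ε`-monotone operation, on tuples from `K^ε`. -/
def sigmaClosed (e : BoundedLatticeHom A C) {n : ℕ} (ε : Fin n → Pol) (f : (Fin n → A) → A)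
    (k : Fin n → C) : C :=
  sInf {c | ∃ a : Fin n → A, PolLE ε k (fun i => e (a i)) ∧ c = e (f a)}

/-- The `σ`-extension of an `ε`-monotone operation. -/
def sigmaExt (e : BoundedLatticeHom A C) {n : ℕ} (ε : Fin n → Pol) (f : (Fin n → A) → A)
    (u : Fin n → C) : C :=
  sSup {c | ∃ k : Fin n → C, PolClosed e ε k ∧ PolLE ε k u ∧ c = sigmaClosed e ε f k}

/-- The `π`-extension of an `ε`-monotone operation, on tuples from `O^ε`. -/
def piOpen (e : BoundedLatticeHom A C) {n : ℕ} (ε : Fin n → Pol) (g : (Fin n → A) → A)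
    (o : Fin n → C) : C :=
  sSup {c | ∃ a : Fin n → A, PolLE ε (fun i => e (a i)) o ∧ c = e (g a)}

/-- The `π`-extension of an `ε`-monotone operation. -/
def piExt (e : BoundedLatticeHom A C) {n : ℕ} (ε : Fin n → Pol) (g : (Fin n → A) → A)
    (u : Fin n → C) : C :=
  sInf {c | ∃ o : Fin n → C, PolOpen e ε o ∧ PolLE ε u o ∧ c = piOpen e ε g o}

/-- The operations of the canonical extension `A^δ` of a lattice expansion: the `σ`-extensions of
the operations in `F` and the `π`-extensions of the operations in `G`. -/
def LatticeExpansion.canonicalExtension {L : Signature.{u}} (𝔸 : LatticeExpansion L A)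
    (e : BoundedLatticeHom A C) : Ops L C where
  opF f := sigmaExt e (L.epsF f) (𝔸.opF f)
  opG g := piExt e (L.epsG g) (𝔸.opG g)

end CanonicalExtension

end LatExp

/-!
Preprocessing preserves validity in every normal algebra. In the second stage, work in `C` with
assignments that send nominals to closed elements and co-nominals to open ones. Going down, each
step preserves validity of the system for the assignments that send proposition letters into `A`;
going up, it reflects validity for all assignments in `C`. A pure system does not distinguish the
two classes of assignments, which closes the circle.

* Approximation is sound because the connectives along an SLR branch are residuated in `C`, so
  that it suffices to test the closed elements below the subterm that is taken out.
* The Ackermann rules are sound for assignments into `A` because the inequalities in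
  `S` always have syntactically closed left-hand sides and syntactically open right-hand sides:
  if they hold when `p` takes the closed value of `⋁ α_i`, then, by compactness, they hold when
  `p` takes some value in `A` above it.

Since the dual of a canonical extension is a canonical extension, with `f^σ` and `g^π` exchanged,
every notion is parametrised by a sign `Pol`, and each argument is given once for both signs.
-/

namespace LatExp

open Function

/-! ### Lattices up to a sign -/

namespace Pol

@[simp]
theorem op_op (s : Pol) : s.op.op = s := by cases s <;> rfl

@[simp]
theorem pos_through (ε : Pol) : pos.through ε = ε := by cases ε <;> rfl

@[simp]
theorem neg_through (ε : Pol) : neg.through ε = ε.op := by cases ε <;> rfl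

theorem through_op (s ε : Pol) : s.op.through ε = (s.through ε).op := by
  cases ε <;> rfl

theorem eq_or_eq_op (s t : Pol) : s = t ∨ s = t.op := by
  cases s <;> cases t <;> simp [op]

variable {A : Type*}

/-- The order of `A` for the sign `+`, and its dual for the sign `-`. -/
def le [LE A] : Pol → A → A → Prop
  | pos, x, y => x ≤ y
  | neg, x, y => y ≤ x

/-- The binary join for the sign `+`, the binary meet for the sign `-`. -/
def sup [Lattice A] : Pol → A → A → A
  | pos, x, y => x ⊔ y
  | neg, x, y => x ⊓ y

/-- The least element for the sign `+`, the greatest element for the sign `-`. -/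
def bot [LE A] [BoundedOrder A] : Pol → A
  | pos => ⊥
  | neg => ⊤

/-- The join of a set for the sign `+`, its meet for the sign `-`. -/
def sSup [CompleteLattice A] : Pol → Set A → A
  | pos, X => SupSet.sSup X
  | neg, X => InfSet.sInf X

@[simp]
theorem le_op [LE A] {s : Pol} {x y : A} : s.op.le x y ↔ s.le y x := by
  cases s <;> rfl

section Preorder

variable [Preorder A]

@[refl]
protected theorem le_refl (s : Pol) (x : A) : s.le x x := by
  cases s <;> exact _root_.le_refl x

protected theorem le_of_eq (s : Pol) {x y : A} (h : x = y) : s.le x y := h ▸ s.le_refl x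

protected theorem le_trans {s : Pol} {x y z : A} (h : s.le x y) (h' : s.le y z) : s.le x z := by
  cases s
  · exact _root_.le_trans h h'
  · exact _root_.le_trans h' h

instance (s : Pol) : IsTrans A s.le := ⟨fun _ _ _ => Pol.le_trans⟩

end Preorder

section PartialOrder

variable [PartialOrder A]

protected theorem le_antisymm {s : Pol} {x y : A} (h : s.le x y) (h' : s.le y x) : x = y := by
  cases s
  · exact _root_.le_antisymm h h'
  · exact _root_.le_antisymm h' h

protected theorem eq_of_forall_le_iff {s : Pol} {x y : A} (h : ∀ z, s.le x z ↔ s.le y z) :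
    x = y :=
  Pol.le_antisymm ((h y).2 (s.le_refl y)) ((h x).1 (s.le_refl x))

end PartialOrder

section BoundedOrder

variable [LE A] [BoundedOrder A]

protected theorem bot_le (s : Pol) (x : A) : s.le s.bot x := by
  cases s
  · exact _root_.bot_le (a := x)
  · exact _root_.le_top (a := x)

protected theorem le_top (s : Pol) (x : A) : s.le x s.op.bot := le_op.1 (s.op.bot_le x)

end BoundedOrder

section Lattice

variable [Lattice A] {s : Pol} {x y z : A}

protected theorem sup_le_iff : s.le (s.sup x y) z ↔ s.le x z ∧ s.le y z := by
  cases s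
  · exact _root_.sup_le_iff
  · exact le_inf_iff

protected theorem le_sup_left (s : Pol) (x y : A) : s.le x (s.sup x y) :=
  (Pol.sup_le_iff.1 (s.le_refl _)).1

protected theorem le_sup_right (s : Pol) (x y : A) : s.le y (s.sup x y) :=
  (Pol.sup_le_iff.1 (s.le_refl _)).2

protected theorem sup_le (hx : s.le x z) (hy : s.le y z) : s.le (s.sup x y) z :=
  Pol.sup_le_iff.2 ⟨hx, hy⟩

theorem op_sup_le_left (s : Pol) (x y : A) : s.le (s.op.sup x y) x :=
  le_op.1 (s.op.le_sup_left x y)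

theorem op_sup_le_right (s : Pol) (x y : A) : s.le (s.op.sup x y) y :=
  le_op.1 (s.op.le_sup_right x y)

theorem le_op_sup (hx : s.le z x) (hy : s.le z y) : s.le z (s.op.sup x y) :=
  le_op.1 (Pol.sup_le (le_op.2 hx) (le_op.2 hy))

protected theorem sup_eq_right : s.sup x y = y ↔ s.le x y := by
  cases s
  · exact _root_.sup_eq_right
  · exact inf_eq_right

theorem sup_le_sup (t : Pol) {x' y' : A} (hx : s.le x x') (hy : s.le y y') :
    s.le (t.sup x y) (t.sup x' y') := by
  cases s <;> cases t
  exacts [_root_.sup_le_sup hx hy, inf_le_inf hx hy, _root_.sup_le_sup hx hy, inf_le_inf hx hy]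

end Lattice

section CompleteLattice

variable [CompleteLattice A] {s : Pol} {X : Set A} {x y : A}

protected theorem sSup_le_iff : s.le (s.sSup X) y ↔ ∀ x ∈ X, s.le x y := by
  cases s
  · exact _root_.sSup_le_iff
  · exact le_sInf_iff

protected theorem le_sSup (hx : x ∈ X) : s.le x (s.sSup X) :=
  Pol.sSup_le_iff.1 (s.le_refl _) x hx

theorem le_op_sSup_iff : s.le y (s.op.sSup X) ↔ ∀ x ∈ X, s.le y x := by
  rw [← le_op, Pol.sSup_le_iff]
  simp only [le_op]

theorem op_sSup_le (hx : x ∈ X) : s.le (s.op.sSup X) x := le_op.1 (Pol.le_sSup hx)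

protected theorem sSup_pair (s : Pol) (x y : A) : s.sSup {x, y} = s.sup x y := by
  cases s
  · exact _root_.sSup_pair
  · exact sInf_pair

protected theorem sSup_empty (s : Pol) : s.sSup (∅ : Set A) = s.bot := by
  cases s
  · exact _root_.sSup_empty
  · exact sInf_empty

end CompleteLattice

end Pol

/-! ### Operators -/

section Operator

variable {ι A : Type*} {s : Pol} {σ : ι → Pol}

/-- `h` is monotone in the order of sign `σ i` in the `i`-th coordinate and the order of sign `s`
on values. -/
def SignedMonotone {B : Type*} [LE A] [LE B] (s : Pol) (σ : ι → Pol) (h : (ι → A) → B) : Prop :=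
  ∀ a b, (∀ i, (σ i).le (a i) (b i)) → s.le (h a) (h b)

theorem SignedMonotone.op {B : Type*} [LE A] [LE B] {h : (ι → A) → B}
    (hh : SignedMonotone s σ h) : SignedMonotone s.op (fun i => (σ i).op) h :=
  fun _ _ hab => Pol.le_op.2 (hh _ _ fun i => Pol.le_op.1 (hab i))

theorem SignedMonotone.through {B : Type*} [LE A] [LE B] {ε : ι → Pol} {h : (ι → A) → B}
    (hh : SignedMonotone s (fun i => s.through (ε i)) h) (t : Pol) :
    SignedMonotone t (fun i => t.through (ε i)) h := by
  rcases t.eq_or_eq_op s with rfl | rfl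
  · exact hh
  · simpa only [Pol.through_op] using hh.op

variable [DecidableEq ι]

theorem SignedMonotone.update {B : Type*} [Preorder A] [LE B] {h : (ι → A) → B}
    (hh : SignedMonotone s σ h) {a b : ι → A} {i : ι} {x y : A} (hxy : (σ i).le x y)
    (hab : ∀ j, j ≠ i → (σ j).le (a j) (b j)) : s.le (h (update a i x)) (h (update b i y)) :=
  hh _ _ fun j => by
    rcases eq_or_ne j i with rfl | hj
    · simpa using hxy
    · simpa [hj] using hab j hj

/-- `h` sends the finite joins of sign `σ i` in the `i`-th coordinate to finite joins of
sign `s`. -/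
structure IsOperator [Lattice A] [BoundedOrder A] (s : Pol) (σ : ι → Pol)
    (h : (ι → A) → A) : Prop where
  map_sup : ∀ i a x y, h (update a i ((σ i).sup x y)) =
    s.sup (h (update a i x)) (h (update a i y))
  map_bot : ∀ i a, h (update a i (σ i).bot) = s.bot

/-- `H` sends the joins of sign `σ i` in the `i`-th coordinate to joins of sign `s`; the latter
joins are described by their upper bounds. -/
def IsCompleteOperator [CompleteLattice A] (s : Pol) (σ : ι → Pol) (H : (ι → A) → A) : Prop :=
  ∀ i a X y, s.le (H (update a i ((σ i).sSup X))) y ↔ ∀ x ∈ X, s.le (H (update a i x)) y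

theorem IsOperator.le_update [Lattice A] [BoundedOrder A] {h : (ι → A) → A}
    (hh : IsOperator s σ h) {i : ι} {a : ι → A} {x : A} (hx : (σ i).le (a i) x) :
    s.le (h a) (h (update a i x)) := by
  rw [← Pol.sup_eq_right.2 hx, hh.map_sup, update_eq_self]
  exact s.le_sup_left _ _

theorem IsOperator.mono [Finite ι] [Lattice A] [BoundedOrder A] {h : (ι → A) → A}
    (hh : IsOperator s σ h) : SignedMonotone s σ h := by
  cases nonempty_fintype ι
  intro a b hab
  have key (T : Finset ι) : s.le (h a) (h (T.piecewise b a)) := by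
    induction T using Finset.induction_on with
    | empty => simpa using s.le_refl (h a)
    | insert j T hj ih =>
      rw [Finset.piecewise_insert]
      exact Pol.le_trans ih (hh.le_update (by simpa [hj] using hab j))
  simpa using key Finset.univ

theorem IsCompleteOperator.isOperator [CompleteLattice A] {H : (ι → A) → A}
    (hH : IsCompleteOperator s σ H) : IsOperator s σ H where
  map_sup i a x y := Pol.eq_of_forall_le_iff fun z => by
    rw [← Pol.sSup_pair, hH, Pol.sup_le_iff]
    simp
  map_bot i a := Pol.eq_of_forall_le_iff fun z => by
    rw [← Pol.sSup_empty, hH, ← Pol.sSup_empty, Pol.sSup_le_iff]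
    simp

end Operator

section Canonical

variable {ι κ : Type*} {A : Type v} {C : Type w} [Lattice A] [BoundedOrder A] [CompleteLattice C]
  {e : BoundedLatticeHom A C} {s : Pol} {σ : ι → Pol}

/-! ### Closed and open elements -/

theorem map_signed_sup (e : BoundedLatticeHom A C) (s : Pol) (a b : A) :
    e (s.sup a b) = s.sup (e a) (e b) := by
  cases s
  · exact map_sup e a b
  · exact map_inf e a b

theorem map_signed_bot (e : BoundedLatticeHom A C) (s : Pol) : e s.bot = s.bot := by
  cases s
  · exact map_bot e
  · exact map_top e

theorem map_signed_le (e : BoundedLatticeHom A C) {a b : A} (h : s.le a b) :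
    s.le (e a) (e b) := by
  cases s <;> exact OrderHomClass.mono e h

/-- The closed elements for the sign `+`, the open elements for the sign `-`. -/
def signedClosed (e : BoundedLatticeHom A C) : Pol → Set C
  | .pos => closedElts e
  | .neg => openElts e

theorem mem_signedClosed_iff {x : C} :
    x ∈ signedClosed e s ↔ ∃ S : Set A, x = s.op.sSup (e '' S) := by
  cases s <;> rfl

theorem map_mem_signedClosed (e : BoundedLatticeHom A C) (s : Pol) (a : A) :
    e a ∈ signedClosed e s := by
  cases s <;> exact ⟨{a}, by simp⟩

theorem op_sSup_le_of_mem_signedClosed {k : C} (hk : k ∈ signedClosed e s) :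
    s.le (s.op.sSup (e '' {a | s.le k (e a)})) k := by
  obtain ⟨S, rfl⟩ := mem_signedClosed_iff.1 hk
  refine Pol.le_op_sSup_iff.2 ?_
  rintro _ ⟨a, ha, rfl⟩
  exact Pol.op_sSup_le ⟨a, Pol.op_sSup_le ⟨a, ha, rfl⟩, rfl⟩

namespace IsCanonicalExtension

variable (he : IsCanonicalExtension e)
include he

theorem map_signed_le_iff {a b : A} : s.le (e a) (e b) ↔ s.le a b := by
  refine ⟨fun h => Pol.sup_eq_right.1 (he.injective ?_), map_signed_le e⟩
  rw [map_signed_sup, Pol.sup_eq_right.2 h]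

theorem le_of_forall_closed {u y : C} (h : ∀ c ∈ signedClosed e s, s.le c u → s.le c y) :
    s.le u y := by
  cases s
  · obtain ⟨X, hX, rfl⟩ := he.join_of_meets u
    exact sSup_le fun c hc => h c (hX hc) (le_sSup hc)
  · obtain ⟨X, hX, rfl⟩ := he.meet_of_joins u
    exact le_sInf fun c hc => h c (hX hc) (sInf_le hc)

theorem le_of_forall_open {u y : C} (h : ∀ o ∈ signedClosed e s.op, s.le y o → s.le u o) :
    s.le u y :=
  Pol.le_op.1 <| he.le_of_forall_closed fun o ho hyo => Pol.le_op.2 (h o ho (Pol.le_op.1 hyo))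

theorem exists_finite_subset {S T : Set A}
    (h : s.le (s.op.sSup (e '' S)) (s.sSup (e '' T))) :
    ∃ S' T' : Set A, S' ⊆ S ∧ T' ⊆ T ∧ S'.Finite ∧ T'.Finite ∧
      s.le (s.op.sSup (e '' S')) (s.sSup (e '' T')) := by
  cases s
  · exact he.compact S T h
  · obtain ⟨T', S', hT, hS, hTf, hSf, h'⟩ := he.compact T S h
    exact ⟨S', T', hS, hT, hSf, hTf, h'⟩

theorem exists_le_of_directedOn {k : C} (hk : k ∈ signedClosed e s) {D : Set A}
    (hne : D.Nonempty) (hdir : DirectedOn s.le D) (h : s.le k (s.sSup (e '' D))) :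
    ∃ d ∈ D, s.le k (e d) := by
  obtain ⟨S, rfl⟩ := mem_signedClosed_iff.1 hk
  obtain ⟨S', T', hS, hT, -, hTf, hST⟩ := he.exists_finite_subset h
  have : Nonempty D := hne.to_subtype
  have : Finite T' := hTf
  obtain ⟨⟨d, hd⟩, hub⟩ :=
    (directedOn_iff_directed.1 hdir).finite_le fun t : T' => (⟨t, hT t.2⟩ : D)
  refine ⟨d, hd, Pol.le_trans (Pol.le_op_sSup_iff.2 ?_) (Pol.le_trans hST (Pol.sSup_le_iff.2 ?_))⟩
  · rintro _ ⟨a, ha, rfl⟩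
    exact Pol.op_sSup_le ⟨a, hS ha, rfl⟩
  · rintro _ ⟨a, ha, rfl⟩
    exact map_signed_le e (hub ⟨a, ha⟩)

theorem exists_between {k o : C} (hk : k ∈ signedClosed e s) (ho : o ∈ signedClosed e s.op)
    (h : s.le k o) : ∃ a : A, s.le k (e a) ∧ s.le (e a) o := by
  have ho' := op_sSup_le_of_mem_signedClosed ho
  simp only [Pol.op_op, Pol.le_op] at ho'
  obtain ⟨a, hao, hka⟩ := he.exists_le_of_directedOn hk (D := {a | s.le (e a) o})
    ⟨s.bot, by rw [Set.mem_ofPred_eq, map_signed_bot]; exact s.bot_le o⟩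
    (fun a ha b hb => ⟨s.sup a b, by
      rw [Set.mem_ofPred_eq, map_signed_sup]; exact Pol.sup_le ha hb,
      s.le_sup_left a b, s.le_sup_right a b⟩) (Pol.le_trans h ho')
  exact ⟨a, hka, hao⟩

theorem mem_signedClosed {x : C}
    (h : ∀ o ∈ signedClosed e s.op, s.le x o → ∃ a : A, s.le x (e a) ∧ s.le (e a) o) :
    x ∈ signedClosed e s := by
  refine mem_signedClosed_iff.2 ⟨{a | s.le x (e a)}, Pol.le_antisymm (s := s) ?_ ?_⟩
  · refine Pol.le_op_sSup_iff.2 ?_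
    rintro _ ⟨a, ha, rfl⟩
    exact ha
  · refine he.le_of_forall_open fun o ho hxo => ?_
    obtain ⟨a, hxa, hao⟩ := h o ho hxo
    exact Pol.le_trans (Pol.op_sSup_le ⟨a, hxa, rfl⟩) hao

end IsCanonicalExtension

/-- The tuples of elements of `A` above the tuple `k`, in the order of sign `σ i` in the `i`-th
coordinate. -/
def tuplesAbove (e : BoundedLatticeHom A C) (σ : ι → Pol) (k : ι → C) : Set (ι → A) :=
  {a | ∀ i, (σ i).le (k i) (e (a i))}

theorem tuplesAbove_nonempty (e : BoundedLatticeHom A C) (σ : ι → Pol) (k : ι → C) :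
    (tuplesAbove e σ k).Nonempty :=
  ⟨fun i => (σ i).op.bot, fun i => by rw [map_signed_bot]; exact (σ i).le_top _⟩

theorem sup_mem_tuplesAbove {k : ι → C} {a b : ι → A} (ha : a ∈ tuplesAbove e σ k)
    (hb : b ∈ tuplesAbove e σ k) : (fun i => (σ i).op.sup (a i) (b i)) ∈ tuplesAbove e σ k :=
  fun i => by rw [map_signed_sup]; exact Pol.le_op_sup (ha i) (hb i)

theorem update_mem_tuplesAbove [DecidableEq ι] {k : ι → C} {a : ι → A} {i : ι} {b : A}
    (ha : ∀ j, j ≠ i → (σ j).le (k j) (e (a j))) (hb : (σ i).le (k i) (e b)) :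
    update a i b ∈ tuplesAbove e σ k := fun j => by
  rcases eq_or_ne j i with rfl | hj
  · simpa using hb
  · simpa [hj] using ha j hj

theorem exists_mem_tuplesAbove_forall_le [Finite κ] {k : ι → C} (a : κ → ι → A)
    (ha : ∀ j, a j ∈ tuplesAbove e σ k) :
    ∃ c ∈ tuplesAbove e σ k, ∀ j i, (σ i).le (c i) (a j i) := by
  have hdir : Directed (fun a b : ι → A => ∀ i, (σ i).op.le (a i) (b i))
      ((↑) : tuplesAbove e σ k → ι → A) := fun a b =>
    ⟨⟨_, sup_mem_tuplesAbove a.2 b.2⟩, fun i => (σ i).op.le_sup_left _ _,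
      fun i => (σ i).op.le_sup_right _ _⟩
  have : IsTrans (ι → A) fun a b => ∀ i, (σ i).op.le (a i) (b i) :=
    ⟨fun _ _ _ hab hbc i => Pol.le_trans (hab i) (hbc i)⟩
  have := (tuplesAbove_nonempty e σ k).to_subtype
  obtain ⟨c, hc⟩ := hdir.finite_le fun j => ⟨a j, ha j⟩
  exact ⟨c, c.2, fun j i => Pol.le_op.1 (hc j i)⟩

theorem SignedMonotone.directedOn_image_tuplesAbove {h : (ι → A) → A}
    (hh : SignedMonotone s σ h) (k : ι → C) :
    DirectedOn s.op.le (h '' tuplesAbove e σ k) := by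
  rintro _ ⟨a, ha, rfl⟩ _ ⟨b, hb, rfl⟩
  exact ⟨_, ⟨_, sup_mem_tuplesAbove ha hb, rfl⟩,
    Pol.le_op.2 (hh _ _ fun i => (σ i).op_sup_le_left _ _),
    Pol.le_op.2 (hh _ _ fun i => (σ i).op_sup_le_right _ _)⟩

theorem IsCanonicalExtension.exists_mem_tuplesAbove_le (he : IsCanonicalExtension e)
    {h : (ι → A) → A} (hh : SignedMonotone s σ h) {k : ι → C} {o : C}
    (ho : o ∈ signedClosed e s.op)
    (hko : s.le (s.op.sSup (e '' (h '' tuplesAbove e σ k))) o) :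
    ∃ a ∈ tuplesAbove e σ k, s.le (e (h a)) o := by
  obtain ⟨_, ⟨a, ha, rfl⟩, hoa⟩ := he.exists_le_of_directedOn ho
    ((tuplesAbove_nonempty e σ k).image h) (hh.directedOn_image_tuplesAbove k) (Pol.le_op.2 hko)
  exact ⟨a, ha, Pol.le_op.1 hoa⟩

/-! ### Operations that interpolate -/

/-- `H` is monotone and continuous at closed tuples `k`, up to signs: an open element above `H k`
is already above the value of `H` at some tuple of `A` above `k`, with an element of `A` in
between. -/
structure Interpolates (e : BoundedLatticeHom A C) (s : Pol) (σ : ι → Pol)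
    (H : (ι → C) → C) : Prop where
  mono : SignedMonotone s σ H
  exists_between : ∀ k : ι → C, (∀ i, k i ∈ signedClosed e (σ i)) → ∀ o ∈ signedClosed e s.op,
    s.le (H k) o → ∃ a ∈ tuplesAbove e σ k, ∃ b : A, s.le (H fun i => e (a i)) (e b) ∧ s.le (e b) o

namespace Interpolates

variable {H : (ι → C) → C}

theorem mem_signedClosed (he : IsCanonicalExtension e) (hH : Interpolates e s σ H) {k : ι → C}
    (hk : ∀ i, k i ∈ signedClosed e (σ i)) : H k ∈ signedClosed e s :=
  he.mem_signedClosed fun o ho hko => by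
    obtain ⟨a, hka, b, hab, hbo⟩ := hH.exists_between k hk o ho hko
    exact ⟨b, Pol.le_trans (hH.mono _ _ hka) hab, hbo⟩

theorem const (he : IsCanonicalExtension e) (σ : ι → Pol) {c : C} (hc : c ∈ signedClosed e s) :
    Interpolates e s σ fun _ => c where
  mono _ _ _ := s.le_refl c
  exists_between k _ o ho hco := by
    obtain ⟨b, hcb, hbo⟩ := he.exists_between hc ho hco
    obtain ⟨a, hka⟩ := tuplesAbove_nonempty e σ k
    exact ⟨a, hka, b, hcb, hbo⟩

theorem apply (he : IsCanonicalExtension e) (σ : ι → Pol) (i : ι) :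
    Interpolates e (σ i) σ fun u => u i where
  mono _ _ h := h i
  exists_between k hk o ho hko := by
    classical
    obtain ⟨b, hkb, hbo⟩ := he.exists_between (hk i) ho hko
    obtain ⟨a, hka⟩ := tuplesAbove_nonempty e σ k
    exact ⟨update a i b, update_mem_tuplesAbove (fun j _ => hka j) hkb, b,
      (σ i).le_of_eq (by simp), hbo⟩

theorem of_limit (he : IsCanonicalExtension e) (hH : SignedMonotone s σ H) {h : (ι → A) → A}
    (hHh : ∀ a : ι → A, H (fun i => e (a i)) = e (h a))
    (hlim : ∀ k : ι → C, (∀ i, k i ∈ signedClosed e (σ i)) →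
      s.le (s.op.sSup (e '' (h '' tuplesAbove e σ k))) (H k)) : Interpolates e s σ H where
  mono := hH
  exists_between k hk o ho hko := by
    have hh : SignedMonotone s σ h := fun a b hab => he.map_signed_le_iff.1 <| by
      simpa only [hHh] using hH _ _ fun i => map_signed_le e (hab i)
    obtain ⟨a, hka, hao⟩ := he.exists_mem_tuplesAbove_le hh ho (Pol.le_trans (hlim k hk) hko)
    exact ⟨a, hka, h a, s.le_of_eq (hHh a), hao⟩

theorem comp [Finite ι] (he : IsCanonicalExtension e) {τ : ι → Pol} {σ : κ → Pol}
    {G : ι → (κ → C) → C} (hH : Interpolates e s τ H)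
    (hG : ∀ i, Interpolates e (τ i) σ (G i)) :
    Interpolates e s σ fun u => H fun i => G i u where
  mono u v huv := hH.mono _ _ fun i => (hG i).mono _ _ huv
  exists_between k hk o ho hko := by
    obtain ⟨c, hkc, b, hcb, hbo⟩ := hH.exists_between (fun i => G i k)
      (fun i => (hG i).mem_signedClosed he hk) o ho hko
    choose a' hka' b' hab' hbc' using fun i =>
      (hG i).exists_between k hk (e (c i)) (map_mem_signedClosed e _ _) (hkc i)
    obtain ⟨a, hka, haa'⟩ := exists_mem_tuplesAbove_forall_le a' hka'
    refine ⟨a, hka, b, Pol.le_trans (hH.mono _ _ fun i => ?_) hcb, hbo⟩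
    exact Pol.le_trans ((hG i).mono _ _ fun j => map_signed_le e (haa' i j))
      (Pol.le_trans (hab' i) (hbc' i))

/-- The topological core of the Ackermann rules: compactness gives, for each `j`, an element of `A`
between the two sides at `k`. -/
theorem exists_forall_le [Finite κ] (he : IsCanonicalExtension e) {G G' : κ → (ι → C) → C}
    (hG : ∀ j, Interpolates e s σ (G j)) (hG' : ∀ j, Interpolates e s.op σ (G' j)) {k : ι → C}
    (hk : ∀ i, k i ∈ signedClosed e (σ i)) (h : ∀ j, s.le (G j k) (G' j k)) :
    ∃ a ∈ tuplesAbove e σ k, ∀ j, s.le (G j fun i => e (a i)) (G' j fun i => e (a i)) := by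
  choose c hGc hcG' using fun j => he.exists_between ((hG j).mem_signedClosed he hk)
    ((hG' j).mem_signedClosed he hk) (h j)
  choose a₁ hka₁ b₁ hab₁ hbc₁ using fun j =>
    (hG j).exists_between k hk (e (c j)) (map_mem_signedClosed e _ _) (hGc j)
  choose a₂ hka₂ b₂ hab₂ hbc₂ using fun j =>
    (hG' j).exists_between k hk (e (c j)) (map_mem_signedClosed e _ _) (Pol.le_op.2 (hcG' j))
  obtain ⟨a, hka, haa⟩ := exists_mem_tuplesAbove_forall_le (Sum.elim a₁ a₂)
    (Sum.forall.2 ⟨hka₁, hka₂⟩)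
  refine ⟨a, hka, fun j => ?_⟩
  have hGj : s.le (G j fun i => e (a i)) (e (c j)) :=
    Pol.le_trans ((hG j).mono _ _ fun i => map_signed_le e (haa (Sum.inl j) i))
      (Pol.le_trans (hab₁ j) (hbc₁ j))
  have hGj' : s.op.le (G' j fun i => e (a i)) (e (c j)) :=
    Pol.le_trans ((hG' j).mono _ _ fun i => map_signed_le e (haa (Sum.inr j) i))
      (Pol.le_trans (hab₂ j) (hbc₂ j))
  exact Pol.le_trans hGj (Pol.le_op.1 hGj')

end Interpolates

theorem interpolates_sup (he : IsCanonicalExtension e) (t s : Pol) :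
    Interpolates e s (fun _ : Bool => s) fun u => t.sup (u true) (u false) := by
  refine .of_limit he (h := fun a => t.sup (a true) (a false))
    (fun u v huv => Pol.sup_le_sup t (huv true) (huv false))
    (fun a => (map_signed_sup e t _ _).symm) fun k hk => ?_
  rcases t.eq_or_eq_op s with rfl | rfl
  · refine he.le_of_forall_open fun o ho hko => ?_
    rw [Pol.sup_le_iff] at hko
    obtain ⟨a, hka, hao⟩ := he.exists_between (hk true) ho hko.1
    obtain ⟨b, hkb, hbo⟩ := he.exists_between (hk false) ho hko.2
    refine Pol.le_trans (Pol.op_sSup_le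
      ⟨_, ⟨Bool.rec b a, Bool.forall_bool.2 ⟨hkb, hka⟩, rfl⟩, rfl⟩) ?_
    rw [map_signed_sup]
    exact Pol.sup_le hao hbo
  · have hle (i : Bool) : s.le
        (s.op.sSup (e '' ((fun a => s.op.sup (a true) (a false)) ''
          tuplesAbove e (fun _ : Bool => s) k))) (k i) := by
      refine Pol.le_trans (Pol.le_op_sSup_iff.2 ?_) (op_sSup_le_of_mem_signedClosed (hk i))
      rintro _ ⟨b, hkb, rfl⟩
      have hmem : update (fun _ : Bool => s.op.bot) i b ∈ tuplesAbove e (fun _ : Bool => s) k :=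
        update_mem_tuplesAbove (fun j _ => by rw [map_signed_bot]; exact s.le_top _) hkb
      refine Pol.le_trans (Pol.op_sSup_le ⟨_, ⟨_, hmem, rfl⟩, rfl⟩) (map_signed_le e ?_)
      cases i
      · exact Pol.le_trans (s.op_sup_le_right _ _) (s.le_of_eq (by simp))
      · exact Pol.le_trans (s.op_sup_le_left _ _) (s.le_of_eq (by simp))
    exact Pol.le_op_sup (hle true) (hle false)

theorem Interpolates.sup (he : IsCanonicalExtension e) (t : Pol) {G G' : (ι → C) → C}
    (hG : Interpolates e s σ G) (hG' : Interpolates e s σ G') :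
    Interpolates e s σ fun u => t.sup (G u) (G' u) :=
  (interpolates_sup he t s).comp he (G := fun b => cond b G G') (Bool.forall_bool.2 ⟨hG', hG⟩)

/-! ### Extensions of operators -/

section Extension

variable {h : (ι → A) → A} {k u : ι → C}

/-- The meet of the values of `h` on the tuples of `A` above `k`, up to signs: `sigmaClosed` if
`s` is `+`, and `piOpen` if `s` is `-`. -/
def signedExtClosed (e : BoundedLatticeHom A C) (s : Pol) (σ : ι → Pol) (h : (ι → A) → A)
    (k : ι → C) : C :=
  s.op.sSup (e '' (h '' tuplesAbove e σ k))

/-- The extension of an operation to `C`, up to signs: `sigmaExt` if `s` is `+`, and `piExt` if `s`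
is `-`. -/
def signedExt (e : BoundedLatticeHom A C) (s : Pol) (σ : ι → Pol) (h : (ι → A) → A)
    (u : ι → C) : C :=
  s.sSup (signedExtClosed e s σ h ''
    {k | (∀ i, k i ∈ signedClosed e (σ i)) ∧ ∀ i, (σ i).le (k i) (u i)})

theorem signedExt_le_iff {y : C} : s.le (signedExt e s σ h u) y ↔
    ∀ k, (∀ i, k i ∈ signedClosed e (σ i)) → (∀ i, (σ i).le (k i) (u i)) →
      s.le (signedExtClosed e s σ h k) y := by
  simp only [signedExt, Pol.sSup_le_iff, Set.forall_mem_image, Set.mem_ofPred_eq, and_imp]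

theorem signedExtClosed_le {a : ι → A} (ha : a ∈ tuplesAbove e σ k) :
    s.le (signedExtClosed e s σ h k) (e (h a)) :=
  Pol.op_sSup_le ⟨_, ⟨a, ha, rfl⟩, rfl⟩

theorem signedExtClosed_le_signedExt (hk : ∀ i, k i ∈ signedClosed e (σ i))
    (hku : ∀ i, (σ i).le (k i) (u i)) :
    s.le (signedExtClosed e s σ h k) (signedExt e s σ h u) :=
  signedExt_le_iff.1 (s.le_refl _) k hk hku

theorem signedMonotone_signedExt (e : BoundedLatticeHom A C) (s : Pol) (σ : ι → Pol)
    (h : (ι → A) → A) : SignedMonotone s σ (signedExt e s σ h) := fun _ _ huv =>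
  signedExt_le_iff.2 fun _ hk hku =>
    signedExtClosed_le_signedExt hk fun i => Pol.le_trans (hku i) (huv i)

theorem IsCanonicalExtension.signedExt_map (he : IsCanonicalExtension e)
    (hh : SignedMonotone s σ h) (a : ι → A) :
    signedExt e s σ h (fun i => e (a i)) = e (h a) := by
  refine Pol.le_antisymm (s := s)
    (signedExt_le_iff.2 fun k _ hka => signedExtClosed_le hka)
    (Pol.le_trans (Pol.le_op_sSup_iff.2 ?_) (signedExtClosed_le_signedExt
      (fun i => map_mem_signedClosed e _ _) fun i => (σ i).le_refl _))
  rintro _ ⟨_, ⟨b, hab, rfl⟩, rfl⟩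
  exact map_signed_le e (hh _ _ fun i => he.map_signed_le_iff.1 (hab i))

theorem IsCanonicalExtension.interpolates_signedExt (he : IsCanonicalExtension e)
    (hh : SignedMonotone s σ h) : Interpolates e s σ (signedExt e s σ h) :=
  .of_limit he (signedMonotone_signedExt e s σ h) (he.signedExt_map hh) fun _ hk =>
    signedExtClosed_le_signedExt hk fun i => (σ i).le_refl _

theorem IsCanonicalExtension.interpolates_signedExt_op (he : IsCanonicalExtension e)
    (hh : SignedMonotone s σ h) :
    Interpolates e s.op (fun i => (σ i).op) (signedExt e s σ h) := by
  refine .of_limit he (h := h)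
    (fun u v huv => Pol.le_op.2 (signedMonotone_signedExt e s σ h _ _ fun i => Pol.le_op.1 (huv i)))
    (he.signedExt_map hh) fun o ho => ?_
  refine Pol.le_op.2 (signedExt_le_iff.2 fun k hk hko => ?_)
  choose a hka hao using fun i => he.exists_between (hk i) (ho i) (hko i)
  rw [Pol.op_op]
  exact Pol.le_trans (signedExtClosed_le hka)
    (Pol.le_sSup ⟨_, ⟨a, fun i => Pol.le_op.2 (hao i), rfl⟩, rfl⟩)

theorem IsCanonicalExtension.signedExtClosed_le_iff (he : IsCanonicalExtension e)
    (hh : SignedMonotone s σ h) {o : C} (ho : o ∈ signedClosed e s.op) :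
    s.le (signedExtClosed e s σ h k) o ↔ ∃ a ∈ tuplesAbove e σ k, s.le (e (h a)) o :=
  ⟨he.exists_mem_tuplesAbove_le hh ho, fun ⟨_, ha, hao⟩ => Pol.le_trans (signedExtClosed_le ha) hao⟩

variable [DecidableEq ι]

/-- The elements `b` of `A` such that, for some tuple `a` of `A` above `k` in the coordinates other
than `i`, the value of `h` at `a` with `b` in the `i`-th place is below `o`. -/
def coordinateIdeal (e : BoundedLatticeHom A C) (s : Pol) (σ : ι → Pol) (h : (ι → A) → A) (i : ι)
    (k : ι → C) (o : C) : Set A :=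
  {b | ∃ a ∈ tuplesAbove e σ (update k i (σ i).bot), s.le (e (h (update a i b))) o}

section CoordinateIdeal

variable {i : ι} {o : C}

theorem IsOperator.coordinateIdeal_nonempty (hh : IsOperator s σ h) :
    (coordinateIdeal e s σ h i k o).Nonempty := by
  obtain ⟨a, ha⟩ := tuplesAbove_nonempty e σ (update k i (σ i).bot)
  refine ⟨(σ i).bot, a, ha, ?_⟩
  rw [hh.map_bot, map_signed_bot]
  exact s.bot_le o

theorem IsOperator.directedOn_coordinateIdeal [Finite ι] (hh : IsOperator s σ h) :
    DirectedOn (σ i).le (coordinateIdeal e s σ h i k o) := by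
  rintro x ⟨a, ha, hax⟩ y ⟨b, hb, hby⟩
  refine ⟨(σ i).sup x y, ⟨_, sup_mem_tuplesAbove ha hb, ?_⟩,
    (σ i).le_sup_left x y, (σ i).le_sup_right x y⟩
  rw [hh.map_sup, map_signed_sup]
  exact Pol.sup_le
    (Pol.le_trans (map_signed_le e
      (hh.mono.update ((σ i).le_refl x) fun j _ => (σ j).op_sup_le_left _ _)) hax)
    (Pol.le_trans (map_signed_le e
      (hh.mono.update ((σ i).le_refl y) fun j _ => (σ j).op_sup_le_right _ _)) hby)

theorem signedExtClosed_le_of_mem_coordinateIdeal {b : A}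
    (hb : b ∈ coordinateIdeal e s σ h i k o) (hkb : (σ i).le (k i) (e b)) :
    s.le (signedExtClosed e s σ h k) o := by
  obtain ⟨a, ha, hao⟩ := hb
  refine Pol.le_trans (signedExtClosed_le (update_mem_tuplesAbove (fun j hj => ?_) hkb)) hao
  simpa [hj] using ha j

theorem IsCanonicalExtension.le_sSup_coordinateIdeal (he : IsCanonicalExtension e)
    (hh : SignedMonotone s σ h) (hk : ∀ j, k j ∈ signedClosed e (σ j))
    (ho : o ∈ signedClosed e s.op) (hku : ∀ j, j ≠ i → (σ j).le (k j) (u j)) {x : C}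
    (hx : s.le (signedExt e s σ h (update u i x)) o) :
    (σ i).le x ((σ i).sSup (e '' coordinateIdeal e s σ h i k o)) := by
  refine he.le_of_forall_closed fun c hc hcx => ?_
  have hkc : ∀ j, update k i c j ∈ signedClosed e (σ j) := fun j => by
    rcases eq_or_ne j i with rfl | hj
    · simpa using hc
    · simpa [hj] using hk j
  have hle : ∀ j, (σ j).le (update k i c j) (update u i x j) := fun j => by
    rcases eq_or_ne j i with rfl | hj
    · simpa using hcx
    · simpa [hj] using hku j hj
  obtain ⟨a, ha, hao⟩ := (he.signedExtClosed_le_iff hh ho).1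
    (Pol.le_trans (signedExtClosed_le_signedExt hkc hle) hx)
  have hmem : a ∈ tuplesAbove e σ (update k i (σ i).bot) := fun j => by
    rcases eq_or_ne j i with rfl | hj
    · simpa using (σ j).bot_le _
    · simpa [hj] using ha j
  have hca : (σ i).le c (e (a i)) := by simpa using ha i
  exact Pol.le_trans hca (Pol.le_sSup ⟨a i, ⟨a, hmem, by simpa using hao⟩, rfl⟩)

end CoordinateIdeal

theorem IsCanonicalExtension.isCompleteOperator_signedExt [Finite ι] (he : IsCanonicalExtension e)
    (hh : IsOperator s σ h) : IsCompleteOperator s σ (signedExt e s σ h) := by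
  refine fun i u X y => ⟨fun hy x hx => Pol.le_trans
    ((signedMonotone_signedExt e s σ h).update (Pol.le_sSup hx) fun j _ => (σ j).le_refl _) hy,
    fun hX => he.le_of_forall_open fun o ho hyo => signedExt_le_iff.2 fun k hk hku => ?_⟩
  have hki : (σ i).le (k i) ((σ i).sSup X) := by simpa using hku i
  have hX' : (σ i).le ((σ i).sSup X) ((σ i).sSup (e '' coordinateIdeal e s σ h i k o)) :=
    Pol.sSup_le_iff.2 fun x hx => he.le_sSup_coordinateIdeal hh.mono hk ho
      (fun j hj => by simpa [hj] using hku j) (Pol.le_trans (hX x hx) hyo)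
  obtain ⟨b, hb, hkb⟩ := he.exists_le_of_directedOn (hk i) hh.coordinateIdeal_nonempty
    hh.directedOn_coordinateIdeal (Pol.le_trans hki hX')
  exact signedExtClosed_le_of_mem_coordinateIdeal hb hkb

end Extension

/-! ### Residuals -/

section Residual

variable [DecidableEq ι] {H : (ι → C) → C} {i : ι} {u : ι → C} {x y : C}

/-- The residual of `H` in the `i`-th coordinate; the `i`-th argument of the residual is the bound
on the values of `H`. -/
def residual (s : Pol) (σ : ι → Pol) (H : (ι → C) → C) (i : ι) (u : ι → C) : C :=
  (σ i).sSup {x | s.le (H (update u i x)) (u i)}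

namespace IsCompleteOperator

theorem le_residual_iff [Finite ι] (hH : IsCompleteOperator s σ H) :
    (σ i).le x (residual s σ H i u) ↔ s.le (H (update u i x)) (u i) :=
  ⟨fun h => Pol.le_trans (hH.isOperator.mono.update h fun j _ => (σ j).le_refl (u j))
    ((hH i u _ _).2 fun _ hx => hx), fun h => Pol.le_sSup h⟩

theorem le_iff_le_residual [Finite ι] (hH : IsCompleteOperator s σ H) :
    s.le (H u) y ↔ (σ i).le (u i) (residual s σ H i (update u i y)) := by
  simp only [hH.le_residual_iff, update_idem, update_eq_self, update_self]

theorem residual [Finite ι] (hH : IsCompleteOperator s σ H) (i : ι) :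
    IsCompleteOperator (σ i).op (update σ i s.op) (residual s σ H i) := by
  intro j u X y
  simp only [Pol.le_op, hH.le_residual_iff]
  rcases eq_or_ne j i with rfl | hj
  · simp only [update_idem, update_self, Pol.le_op_sSup_iff]
  · simp only [update_of_ne hj, update_of_ne hj.symm, update_comm hj]
    exact hH j _ X _

end IsCompleteOperator

theorem Interpolates.residual [Finite ι] (hH : Interpolates e s σ H)
    (hcomp : IsCompleteOperator s σ H) (i : ι) :
    Interpolates e (σ i).op (update σ i s.op) (residual s σ H i) where
  mono := (hcomp.residual i).isOperator.mono
  exists_between k hk o ho hko := by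
    have hki : k i ∈ signedClosed e s.op := by simpa using hk i
    rw [Pol.op_op] at ho
    rw [Pol.le_op, hcomp.le_residual_iff] at hko
    obtain ⟨a, ha, b, hab, hbk⟩ := hH.exists_between (update k i o) (fun j => by
      rcases eq_or_ne j i with rfl | hj
      · simpa using ho
      · simpa [hj] using hk j) (k i) hki hko
    refine ⟨update a i b, update_mem_tuplesAbove (fun j hj => ?_) (by simpa using hbk), a i, ?_, ?_⟩
    · simpa [hj] using ha j
    · have hupdate : update (fun j => e (update a i b j)) i (e (a i)) = fun j => e (a j) := by
        rw [← comp_def e, comp_update, update_idem, ← comp_update, update_eq_self, comp_def]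
      simpa [hcomp.le_residual_iff, hupdate] using hab
    · simpa using ha i

end Residual

section Fin

variable {n : ℕ} {ε : Fin n → Pol} {x y : Fin n → C}

theorem polLE_iff : PolLE ε x y ↔ ∀ i, (ε i).le (x i) (y i) :=
  forall_congr' fun i => by cases ε i <;> rfl

theorem polClosed_iff : PolClosed e ε x ↔ ∀ i, x i ∈ signedClosed e (ε i) :=
  forall_congr' fun i => by cases ε i <;> rfl

theorem polOpen_iff : PolOpen e ε x ↔ ∀ i, x i ∈ signedClosed e (ε i).op :=
  forall_congr' fun i => by cases ε i <;> rfl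

theorem sigmaClosed_eq (ε : Fin n → Pol) (f : (Fin n → A) → A) :
    sigmaClosed e ε f = signedExtClosed e .pos ε f := by
  funext k
  rw [signedExtClosed, Set.image_image]
  simp only [sigmaClosed, tuplesAbove, polLE_iff, Set.image, Set.mem_ofPred_eq, eq_comm]
  rfl

theorem piOpen_eq (ε : Fin n → Pol) (g : (Fin n → A) → A) :
    piOpen e ε g = signedExtClosed e .neg (fun i => (ε i).op) g := by
  funext k
  rw [signedExtClosed, Set.image_image]
  simp only [piOpen, tuplesAbove, polLE_iff, Set.image, Set.mem_ofPred_eq, eq_comm, Pol.le_op]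
  rfl

theorem sigmaExt_eq (ε : Fin n → Pol) (f : (Fin n → A) → A) :
    sigmaExt e ε f = signedExt e .pos (fun i => Pol.pos.through (ε i)) f := by
  funext u
  simp only [sigmaExt, signedExt, sigmaClosed_eq, polLE_iff, polClosed_iff, Set.image,
    Set.mem_ofPred_eq, eq_comm, and_assoc, Pol.pos_through, Pol.sSup]

theorem piExt_eq (ε : Fin n → Pol) (g : (Fin n → A) → A) :
    piExt e ε g = signedExt e .neg (fun i => Pol.neg.through (ε i)) g := by
  funext u
  simp only [piExt, signedExt, piOpen_eq, polLE_iff, polOpen_iff, Set.image, Set.mem_ofPred_eq,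
    eq_comm, and_assoc, Pol.neg_through, Pol.sSup, Pol.le_op]

end Fin

end Canonical

/-! ### Values of terms -/

section Eval

variable {L : Signature.{u}} {V : Type} {A : Type v} [Lattice A] [BoundedOrder A]

/-- The operations of `O` are normal: they preserve and reverse finite joins and meets as in
`LatticeExpansion`, up to signs. -/
structure Ops.IsNormal (O : Ops L A) : Prop where
  opF : ∀ f, IsOperator .pos (fun i => Pol.pos.through (L.epsF f i)) (O.opF f)
  opG : ∀ g, IsOperator .neg (fun i => Pol.neg.through (L.epsG g i)) (O.opG g)

theorem LatticeExpansion.isNormal (𝔸 : LatticeExpansion L A) : 𝔸.toOps.IsNormal where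
  opF f :=
    { map_sup i a x y := by
        cases h : L.epsF f i
        exacts [𝔸.f_sup f i h a x y, 𝔸.f_inf f i h a x y]
      map_bot i a := by
        cases h : L.epsF f i
        exacts [𝔸.f_bot f i h a, 𝔸.f_top f i h a] }
  opG g :=
    { map_sup i a x y := by
        cases h : L.epsG g i
        exacts [𝔸.g_inf g i h a x y, 𝔸.g_sup g i h a x y]
      map_bot i a := by
        cases h : L.epsG g i
        exacts [𝔸.g_top g i h a, 𝔸.g_bot g i h a] }

variable {O : Ops L A}

namespace Term

theorem eval_congr {v v' : V → A} : ∀ t : Term L V, (∀ x, t.Occurs x → v x = v' x) →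
    t.eval O v = t.eval O v'
  | .atom x, h => h x rfl
  | .bot, _ => rfl
  | .top, _ => rfl
  | .meet s t, h => congrArg₂ (· ⊓ ·) (s.eval_congr fun x hx => h x (.inl hx))
      (t.eval_congr fun x hx => h x (.inr hx))
  | .join s t, h => congrArg₂ (· ⊔ ·) (s.eval_congr fun x hx => h x (.inl hx))
      (t.eval_congr fun x hx => h x (.inr hx))
  | .opF f a, h => congrArg (O.opF f) (funext fun i => (a i).eval_congr fun x hx => h x ⟨i, hx⟩)
  | .opG g a, h => congrArg (O.opG g) (funext fun i => (a i).eval_congr fun x hx => h x ⟨i, hx⟩)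

theorem eval_update_args {n : ℕ} (a : Fin n → Term L V) (i : Fin n) (t : Term L V) (v : V → A) :
    (fun j => (update a i t j).eval O v) = update (fun j => (a j).eval O v) i (t.eval O v) :=
  comp_update (fun t : Term L V => t.eval O v) a i t

section Update

variable [DecidableEq V]

theorem eval_update_of_not_occurs {t : Term L V} {x : V} (hx : ¬ t.Occurs x) (v : V → A) (c : A) :
    t.eval O (update v x c) = t.eval O v :=
  t.eval_congr fun y hy => update_of_ne (by rintro rfl; exact hx hy) _ _

theorem eval_subst (x : V) (r : Term L V) (v : V → A) : ∀ t : Term L V,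
    (subst x r t).eval O v = t.eval O (update v x (r.eval O v))
  | .atom y => by
    rcases eq_or_ne y x with rfl | hy
    · simp [subst, eval]
    · simp [subst, eval, hy]
  | .bot => rfl
  | .top => rfl
  | .meet s t => congrArg₂ (· ⊓ ·) (eval_subst x r v s) (eval_subst x r v t)
  | .join s t => congrArg₂ (· ⊔ ·) (eval_subst x r v s) (eval_subst x r v t)
  | .opF f a => congrArg (O.opF f) (funext fun i => eval_subst x r v (a i))
  | .opG g a => congrArg (O.opG g) (funext fun i => eval_subst x r v (a i))

theorem eval_update_le_eval_update (hO : O.IsNormal) (v : V → A) {x : V} {σ : Pol} {c d : A}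
    (hcd : σ.le c d) : ∀ (t : Term L V) (s : Pol), ¬ t.OccursWith x σ.op s →
      s.le (t.eval O (update v x c)) (t.eval O (update v x d))
  | .atom y, s, h => by
    rcases eq_or_ne y x with rfl | hy
    · have hs : s = σ := (s.eq_or_eq_op σ).resolve_right fun hs => h ⟨rfl, hs⟩
      simpa [eval, hs] using hcd
    · exact s.le_of_eq (by simp [eval, hy])
  | .bot, s, _ => s.le_refl _
  | .top, s, _ => s.le_refl _
  | .meet t t', s, h => Pol.sup_le_sup .neg
      (t.eval_update_le_eval_update hO v hcd s fun h' => h (.inl h'))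
      (t'.eval_update_le_eval_update hO v hcd s fun h' => h (.inr h'))
  | .join t t', s, h => Pol.sup_le_sup .pos
      (t.eval_update_le_eval_update hO v hcd s fun h' => h (.inl h'))
      (t'.eval_update_le_eval_update hO v hcd s fun h' => h (.inr h'))
  | .opF f a, s, h => (hO.opF f).mono.through s _ _ fun i =>
      (a i).eval_update_le_eval_update hO v hcd _ fun h' => h ⟨i, h'⟩
  | .opG g a, s, h => (hO.opG g).mono.through s _ _ fun i =>
      (a i).eval_update_le_eval_update hO v hcd _ fun h' => h ⟨i, h'⟩

end Update

end Term

namespace Ctx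

/-- The value of a context at a value of the placeholder. -/
def eval (O : Ops L A) (v : V → A) : Ctx L V → A → A
  | .hole, c => c
  | .meetL D t, c => D.eval O v c ⊓ t.eval O v
  | .meetR t D, c => t.eval O v ⊓ D.eval O v c
  | .joinL D t, c => D.eval O v c ⊔ t.eval O v
  | .joinR t D, c => t.eval O v ⊔ D.eval O v c
  | .opF f i a D, c => O.opF f (update (fun j => (a j).eval O v) i (D.eval O v c))
  | .opG g i a D, c => O.opG g (update (fun j => (a j).eval O v) i (D.eval O v c))

theorem eval_plug (v : V → A) (γ : Term L V) : ∀ D : Ctx L V,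
    (D.plug γ).eval O v = D.eval O v (γ.eval O v)
  | .hole => rfl
  | .meetL D t => congrArg (· ⊓ t.eval O v) (D.eval_plug v γ)
  | .meetR t D => congrArg (t.eval O v ⊓ ·) (D.eval_plug v γ)
  | .joinL D t => congrArg (· ⊔ t.eval O v) (D.eval_plug v γ)
  | .joinR t D => congrArg (t.eval O v ⊔ ·) (D.eval_plug v γ)
  | .opF f i a D | .opG g i a D => by
    simp only [plug, Term.eval, eval, Term.eval_update_args, D.eval_plug v γ]

theorem SLR.eval_mono (hO : O.IsNormal) (v : V → A) {x y : A} : ∀ {D : Ctx L V} {s : Pol},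
    D.SLR s → (D.sign s).le x y → s.le (D.eval O v x) (D.eval O v y)
  | .hole, _, _, h => h
  | .opF f _ _ _, _, ⟨rfl, hD⟩, h =>
    (hO.opF f).mono.update (SLR.eval_mono hO v hD h) fun _ _ => Pol.le_refl _ _
  | .opG g _ _ _, _, ⟨rfl, hD⟩, h =>
    (hO.opG g).mono.update (SLR.eval_mono hO v hD h) fun _ _ => Pol.le_refl _ _

end Ctx

end Eval

/-! ### Preprocessing -/

section Preprocessing

variable {L : Signature.{u}} {A : Type v} [Lattice A] [BoundedOrder A] {O : Ops L A}

/-- The inequality `i` holds under the assignment `v`. -/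
def Ineq.Holds {V : Type} (O : Ops L A) (v : V → A) (i : Ineq L V) : Prop :=
  i.lhs.eval O v ≤ i.rhs.eval O v

theorem iff_of_reflTransGen {α : Type*} {R : α → α → Prop} {P : α → Prop}
    (hR : ∀ a b, R a b → (P a ↔ P b)) {a b : α} (hab : Relation.ReflTransGen R a b) :
    P a ↔ P b := by
  induction hab with
  | refl => rfl
  | tail _ h ih => exact ih.trans (hR _ _ h)

theorem Ops.IsNormal.valid_subst_iff (hO : O.IsNormal) {σ : Pol} {p : ℕ} {r α β : BTerm L}
    (hr : ∀ v : ℕ → A, σ.le (r.eval O v) (v p)) (hα : ¬ α.OccursWith p σ .pos)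
    (hβ : ¬ β.OccursWith p σ.op .pos) :
    O.Valid ⟨Term.subst p r α, Term.subst p r β⟩ ↔ O.Valid ⟨α, β⟩ := by
  simp only [Ops.Valid, Term.eval_subst]
  refine ⟨fun h v => ?_, fun h v => h _⟩
  have hαv := α.eval_update_le_eval_update hO v (Pol.le_op.2 (hr v)) .pos (by rwa [Pol.op_op])
  have hβv := β.eval_update_le_eval_update hO v (hr v) .pos hβ
  rw [update_eq_self] at hαv hβv
  exact hαv.trans ((h v).trans hβv)

theorem ElimStep.valid_iff (hO : O.IsNormal) {i j : BIneq L} (h : ElimStep i j) :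
    O.Valid i ↔ O.Valid j := by
  cases h with
  | toBot α β p _ hα hβ => exact (hO.valid_subst_iff (σ := .pos) (fun _ => bot_le) hα hβ).symm
  | toTop α β p _ hα hβ => exact (hO.valid_subst_iff (σ := .neg) (fun _ => le_top) hα hβ).symm

theorem DistRedex.eval_eq (hO : O.IsNormal) {s : Pol} {t t' : BTerm L} (h : DistRedex s t t')
    (v : ℕ → A) : t.eval O v = t'.eval O v := by
  cases h with
  | fJoin f i h a x y | fMeet f i h a x y =>
    have hO := (hO.opF f).map_sup i (fun j => (a j).eval O v) (x.eval O v) (y.eval O v)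
    rw [h] at hO
    simp only [Term.eval, Term.eval_update_args]
    exact hO
  | gMeet g i h a x y | gJoin g i h a x y =>
    have hO := (hO.opG g).map_sup i (fun j => (a j).eval O v) (x.eval O v) (y.eval O v)
    rw [h] at hO
    simp only [Term.eval, Term.eval_update_args]
    exact hO

theorem DistStep.valid_iff (hO : O.IsNormal) {i j : BIneq L} (h : DistStep i j) :
    O.Valid i ↔ O.Valid j := by
  refine forall_congr' fun v => ?_
  cases h with
  | left D s s' t h | right D s t t' h => simp only [Ctx.eval_plug, h.eval_eq hO v]

theorem Splits.holds_iff {V : Type} {i j k : Ineq L V} (h : Splits i j k) (v : V → A) :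
    i.Holds O v ↔ j.Holds O v ∧ k.Holds O v := by
  cases h with
  | meet α β γ => exact le_inf_iff
  | join α β γ => exact sup_le_iff

theorem SplitStep.forall_holds_iff {V : Type} {S T : Finset (Ineq L V)} (h : SplitStep S T)
    (v : V → A) : (∀ i ∈ S, i.Holds O v) ↔ ∀ i ∈ T, i.Holds O v := by
  cases h with
  | mk i j k hi h =>
    rw [← Finset.insert_erase hi]
    simp only [Finset.forall_mem_insert, Finset.erase_insert_eq_erase, Finset.erase_idem,
      h.holds_iff, and_assoc]

theorem valid_iff_of_preprocessing (hO : O.IsNormal) {i i₁ i₂ : BIneq L} {I : Finset (BIneq L)}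
    (h₁ : Relation.ReflTransGen ElimStep i i₁) (h₂ : Relation.ReflTransGen DistStep i₁ i₂)
    (h₃ : Relation.ReflTransGen SplitStep {i₂} I) : O.Valid i ↔ ∀ k ∈ I, O.Valid k := by
  have hI (v : ℕ → A) : i₂.Holds O v ↔ ∀ k ∈ I, k.Holds O v := by
    simpa only [Finset.mem_singleton, forall_eq] using
      iff_of_reflTransGen (P := fun S => ∀ k ∈ S, Ineq.Holds O v k)
        (fun _ _ h => h.forall_holds_iff v) h₃
  calc O.Valid i ↔ O.Valid i₁ :=
        iff_of_reflTransGen (P := O.Valid) (fun _ _ => ElimStep.valid_iff hO) h₁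
    _ ↔ O.Valid i₂ := iff_of_reflTransGen (P := O.Valid) (fun _ _ => DistStep.valid_iff hO) h₂
    _ ↔ ∀ v, ∀ k ∈ I, k.Holds O v := forall_congr' hI
    _ ↔ ∀ k ∈ I, O.Valid k := ⟨fun h k hk v => h v k hk, fun h v k hk => h k hk v⟩

end Preprocessing

/-! ### The tense operations on the canonical extension -/

section Tense

variable {L : Signature.{u}} {A : Type v} {C : Type w} [Lattice A] [BoundedOrder A]
  [CompleteLattice C] {𝔸 : LatticeExpansion L A} {e : BoundedLatticeHom A C} {s t : Pol}

theorem through_residualType {n : ℕ} {ε : Fin n → Pol} {i : Fin n}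
    (h : (s.through (ε i)).op = t) :
    (fun j => t.through (residualType ε i j)) = update (fun j => s.through (ε j)) i s.op := by
  subst h
  funext j
  by_cases hj : j = i
  · subst hj
    cases hε : ε j <;> simp [residualType, Pol.through, hε]
  · cases s <;> cases hi : ε i <;> cases hε : ε j <;>
      simp [residualType, Pol.through, Pol.op, hi, hε, hj]

theorem IsCompleteOperator.residual_through {n : ℕ} {ε : Fin n → Pol} {H : (Fin n → C) → C}
    (hH : IsCompleteOperator s (fun j => s.through (ε j)) H) (i : Fin n)
    (h : (s.through (ε i)).op = t) :
    IsCompleteOperator t (fun j => t.through (residualType ε i j))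
      (LatExp.residual s (fun j => s.through (ε j)) H i) := by
  rw [through_residualType h, ← h]
  exact hH.residual i

theorem Interpolates.residual_through {n : ℕ} {ε : Fin n → Pol} {H : (Fin n → C) → C}
    (hH : Interpolates e s (fun j => s.through (ε j)) H)
    (hcomp : IsCompleteOperator s (fun j => s.through (ε j)) H) (i : Fin n)
    (h : (s.through (ε i)).op = t) :
    Interpolates e t (fun j => t.through (residualType ε i j))
      (LatExp.residual s (fun j => s.through (ε j)) H i) := by
  rw [through_residualType h, ← h]
  exact hH.residual hcomp i

/-- The interpretation of the tense language in the canonical extension: `f♯ᵢ` and `g♭ᵢ` are the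
residuals of `f` and `g` in the `i`-th coordinate. -/
def LatticeExpansion.tenseExtension (𝔸 : LatticeExpansion L A) (e : BoundedLatticeHom A C) :
    Ops L.tense C where
  opF
    | .base f => (𝔸.canonicalExtension e).opF f
    | .sharp f i _ => residual .pos (fun j => Pol.pos.through (L.epsF f j))
        ((𝔸.canonicalExtension e).opF f) i
    | .flat g i _ => residual .neg (fun j => Pol.neg.through (L.epsG g j))
        ((𝔸.canonicalExtension e).opG g) i
  opG
    | .base g => (𝔸.canonicalExtension e).opG g
    | .sharp f i _ => residual .pos (fun j => Pol.pos.through (L.epsF f j))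
        ((𝔸.canonicalExtension e).opF f) i
    | .flat g i _ => residual .neg (fun j => Pol.neg.through (L.epsG g j))
        ((𝔸.canonicalExtension e).opG g) i

theorem Term.eval_embed (v : Atom → C) : ∀ t : BTerm L,
    t.embed.eval (𝔸.tenseExtension e) v =
      t.eval (𝔸.canonicalExtension e) (fun p => v (.prop p))
  | .atom _ => rfl
  | .bot => rfl
  | .top => rfl
  | .meet t t' => congrArg₂ (· ⊓ ·) (t.eval_embed v) (t'.eval_embed v)
  | .join t t' => congrArg₂ (· ⊔ ·) (t.eval_embed v) (t'.eval_embed v)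
  | .opF f a => congrArg ((𝔸.canonicalExtension e).opF f) (funext fun i => (a i).eval_embed v)
  | .opG g a => congrArg ((𝔸.canonicalExtension e).opG g) (funext fun i => (a i).eval_embed v)

variable (𝔸) (e)

theorem LatticeExpansion.canonicalExtension_opF (f : L.F) : (𝔸.canonicalExtension e).opF f =
    signedExt e .pos (fun i => Pol.pos.through (L.epsF f i)) (𝔸.opF f) :=
  sigmaExt_eq _ _

theorem LatticeExpansion.canonicalExtension_opG (g : L.G) : (𝔸.canonicalExtension e).opG g =
    signedExt e .neg (fun i => Pol.neg.through (L.epsG g i)) (𝔸.opG g) :=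
  piExt_eq _ _

variable {e}

namespace IsCanonicalExtension

variable (he : IsCanonicalExtension e)
include he

theorem canonicalExtension_opF_map (f : L.F) (a : Fin (L.arF f) → A) :
    (𝔸.canonicalExtension e).opF f (fun i => e (a i)) = e (𝔸.opF f a) := by
  rw [𝔸.canonicalExtension_opF, he.signedExt_map (𝔸.isNormal.opF f).mono]

theorem canonicalExtension_opG_map (g : L.G) (a : Fin (L.arG g) → A) :
    (𝔸.canonicalExtension e).opG g (fun i => e (a i)) = e (𝔸.opG g a) := by
  rw [𝔸.canonicalExtension_opG, he.signedExt_map (𝔸.isNormal.opG g).mono]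

theorem eval_canonicalExtension (v : ℕ → A) : ∀ t : BTerm L,
    t.eval (𝔸.canonicalExtension e) (fun p => e (v p)) = e (t.eval 𝔸.toOps v)
  | .atom _ => rfl
  | .bot => (map_bot e).symm
  | .top => (map_top e).symm
  | .meet t t' => by
    simp only [Term.eval, eval_canonicalExtension v t, eval_canonicalExtension v t', map_inf]
  | .join t t' => by
    simp only [Term.eval, eval_canonicalExtension v t, eval_canonicalExtension v t', map_sup]
  | .opF f a => by
    simp only [Term.eval, fun i => eval_canonicalExtension v (a i),
      he.canonicalExtension_opF_map]
  | .opG g a => by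
    simp only [Term.eval, fun i => eval_canonicalExtension v (a i),
      he.canonicalExtension_opG_map]

theorem isCompleteOperator_opF (f : L.F) :
    IsCompleteOperator .pos (fun i => Pol.pos.through (L.epsF f i))
      ((𝔸.canonicalExtension e).opF f) := by
  rw [𝔸.canonicalExtension_opF]
  exact he.isCompleteOperator_signedExt (𝔸.isNormal.opF f)

theorem isCompleteOperator_opG (g : L.G) :
    IsCompleteOperator .neg (fun i => Pol.neg.through (L.epsG g i))
      ((𝔸.canonicalExtension e).opG g) := by
  rw [𝔸.canonicalExtension_opG]
  exact he.isCompleteOperator_signedExt (𝔸.isNormal.opG g)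

theorem canonicalExtension_isNormal : (𝔸.canonicalExtension e).IsNormal where
  opF f := (he.isCompleteOperator_opF 𝔸 f).isOperator
  opG g := (he.isCompleteOperator_opG 𝔸 g).isOperator

theorem interpolates_opF (f : L.F) (s : Pol) :
    Interpolates e s (fun i => s.through (L.epsF f i)) ((𝔸.canonicalExtension e).opF f) := by
  have hf := (𝔸.isNormal.opF f).mono
  rw [𝔸.canonicalExtension_opF]
  cases s
  · exact he.interpolates_signedExt hf
  · have h := he.interpolates_signedExt_op hf
    simp only [← Pol.through_op] at h
    exact h

theorem interpolates_opG (g : L.G) (s : Pol) :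
    Interpolates e s (fun i => s.through (L.epsG g i)) ((𝔸.canonicalExtension e).opG g) := by
  have hg := (𝔸.isNormal.opG g).mono
  rw [𝔸.canonicalExtension_opG]
  cases s
  · have h := he.interpolates_signedExt_op hg
    simp only [← Pol.through_op] at h
    exact h
  · exact he.interpolates_signedExt hg

theorem isCompleteOperator_tense_opF : ∀ c : TenseF L,
    IsCompleteOperator .pos (fun i => Pol.pos.through (L.tense.epsF c i))
      ((𝔸.tenseExtension e).opF c)
  | .base f => he.isCompleteOperator_opF 𝔸 f
  | .sharp f i h => (he.isCompleteOperator_opF 𝔸 f).residual_through i (by rw [h]; rfl)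
  | .flat g i h => (he.isCompleteOperator_opG 𝔸 g).residual_through i (by rw [h]; rfl)

theorem isCompleteOperator_tense_opG : ∀ c : TenseG L,
    IsCompleteOperator .neg (fun i => Pol.neg.through (L.tense.epsG c i))
      ((𝔸.tenseExtension e).opG c)
  | .base g => he.isCompleteOperator_opG 𝔸 g
  | .sharp f i h => (he.isCompleteOperator_opF 𝔸 f).residual_through i (by rw [h]; rfl)
  | .flat g i h => (he.isCompleteOperator_opG 𝔸 g).residual_through i (by rw [h]; rfl)

theorem tenseExtension_isNormal : (𝔸.tenseExtension e).IsNormal where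
  opF c := (he.isCompleteOperator_tense_opF 𝔸 c).isOperator
  opG c := (he.isCompleteOperator_tense_opG 𝔸 c).isOperator

theorem interpolates_tense_opF : ∀ c : TenseF L,
    Interpolates e .pos (fun i => Pol.pos.through (L.tense.epsF c i))
      ((𝔸.tenseExtension e).opF c)
  | .base f => he.interpolates_opF 𝔸 f .pos
  | .sharp f i h => (he.interpolates_opF 𝔸 f .pos).residual_through
      (he.isCompleteOperator_opF 𝔸 f) i (by rw [h]; rfl)
  | .flat g i h => (he.interpolates_opG 𝔸 g .neg).residual_through
      (he.isCompleteOperator_opG 𝔸 g) i (by rw [h]; rfl)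

theorem interpolates_tense_opG : ∀ c : TenseG L,
    Interpolates e .neg (fun i => Pol.neg.through (L.tense.epsG c i))
      ((𝔸.tenseExtension e).opG c)
  | .base g => he.interpolates_opG 𝔸 g .neg
  | .sharp f i h => (he.interpolates_opF 𝔸 f .pos).residual_through
      (he.isCompleteOperator_opF 𝔸 f) i (by rw [h]; rfl)
  | .flat g i h => (he.interpolates_opG 𝔸 g .neg).residual_through
      (he.isCompleteOperator_opG 𝔸 g) i (by rw [h]; rfl)

end IsCanonicalExtension

end Tense

/-! ### Syntactically closed terms -/

section SynClosed

variable {L : Signature.{u}}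

namespace Term

/-- Syntactically closed terms for the sign `+`, and syntactically open terms for the sign `-`:
in the generation tree whose root has the sign `s`, nominals and the connectives in `F*` outside
`F` occur with the sign `+`, co-nominals and the connectives in `G*` outside `G` with the
sign `-`. -/
def SynClosed : Pol → ETerm L → Prop
  | _, .atom (.prop _) => True
  | s, .atom (.nom _) => s = .pos
  | s, .atom (.conom _) => s = .neg
  | _, .bot => True
  | _, .top => True
  | s, .meet t t' => t.SynClosed s ∧ t'.SynClosed s
  | s, .join t t' => t.SynClosed s ∧ t'.SynClosed s
  | s, .opF c a => (s = .pos ∨ ∃ f, c = .base f) ∧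
      ∀ i, (a i).SynClosed (s.through (L.tense.epsF c i))
  | s, .opG c a => (s = .neg ∨ ∃ g, c = .base g) ∧
      ∀ i, (a i).SynClosed (s.through (L.tense.epsG c i))

theorem synClosed_embed : ∀ (t : BTerm L) (s : Pol), t.embed.SynClosed s
  | .atom _, _ => trivial
  | .bot, _ => trivial
  | .top, _ => trivial
  | .meet t t', s => ⟨t.synClosed_embed s, t'.synClosed_embed s⟩
  | .join t t', s => ⟨t.synClosed_embed s, t'.synClosed_embed s⟩
  | .opF f a, _ => ⟨.inr ⟨f, rfl⟩, fun i => (a i).synClosed_embed _⟩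
  | .opG g a, _ => ⟨.inr ⟨g, rfl⟩, fun i => (a i).synClosed_embed _⟩

theorem SynClosed.subst {p : ℕ} {σ : Pol} {r : ETerm L} (hr : r.SynClosed σ) :
    ∀ {t : ETerm L} {s : Pol}, t.SynClosed s → ¬ t.OccursWith (.prop p) σ.op s →
      (Term.subst (.prop p) r t).SynClosed s
  | .atom x, s, h, h' => by
    rcases eq_or_ne x (.prop p) with rfl | hx
    · have hs : s = σ := (s.eq_or_eq_op σ).resolve_right fun hs => h' ⟨rfl, hs⟩
      simpa [Term.subst, hs] using hr
    · simpa [Term.subst, hx] using h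
  | .bot, _, _, _ => trivial
  | .top, _, _, _ => trivial
  | .meet _ _, _, h, h' | .join _ _, _, h, h' =>
    ⟨hr.subst h.1 fun h => h' (.inl h), hr.subst h.2 fun h => h' (.inr h)⟩
  | .opF _ _, _, h, h' | .opG _ _, _, h, h' =>
    ⟨h.1, fun i => hr.subst (h.2 i) fun h => h' ⟨i, h⟩⟩

end Term

variable {A : Type v} {C : Type w} [Lattice A] [BoundedOrder A] [CompleteLattice C]
  {𝔸 : LatticeExpansion L A} {e : BoundedLatticeHom A C} {s σ : Pol}

/-- The assignments of the soundness proof: nominals are closed and co-nominals are open. The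
proposition letters take values in `P`, which is `A` for validity in `𝔸` and `C` for validity in
the canonical extension. -/
structure Admissible (e : BoundedLatticeHom A C) (P : Set C) (v : Atom → C) : Prop where
  prop : ∀ p, v (.prop p) ∈ P
  nom : ∀ j, v (.nom j) ∈ closedElts e
  conom : ∀ m, v (.conom m) ∈ openElts e

theorem Admissible.mem_signedClosed {v : Atom → C} (hv : Admissible e (Set.range e) v) :
    ∀ {x : Atom}, (Term.atom x : ETerm L).SynClosed s → v x ∈ signedClosed e s
  | .prop p, _ => by
    obtain ⟨a, ha⟩ := hv.prop p
    exact ha ▸ map_mem_signedClosed e s a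
  | .nom j, h => by
    obtain rfl : s = .pos := h
    exact hv.nom j
  | .conom m, h => by
    obtain rfl : s = .neg := h
    exact hv.conom m

namespace Term.SynClosed

theorem interpolates_eval (he : IsCanonicalExtension e) {ι : Type*} {τ : ι → Pol}
    {v : (ι → C) → Atom → C} : ∀ {t : ETerm L} {s : Pol}, t.SynClosed s →
      (∀ x s', (atom x : ETerm L).SynClosed s' → t.OccursWith x s' s →
        Interpolates e s' τ fun u => v u x) →
      Interpolates e s τ fun u => t.eval (𝔸.tenseExtension e) (v u)
  | .atom x, s, ht, hv => hv x s ht ⟨rfl, rfl⟩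
  | .bot, s, _, _ => .const he τ (c := ⊥) (by simpa using map_mem_signedClosed e s (⊥ : A))
  | .top, s, _, _ => .const he τ (c := ⊤) (by simpa using map_mem_signedClosed e s (⊤ : A))
  | .meet _ _, s, ht, hv => .sup he .neg
      (ht.1.interpolates_eval he fun x s' hx h => hv x s' hx (.inl h))
      (ht.2.interpolates_eval he fun x s' hx h => hv x s' hx (.inr h))
  | .join _ _, s, ht, hv => .sup he .pos
      (ht.1.interpolates_eval he fun x s' hx h => hv x s' hx (.inl h))
      (ht.2.interpolates_eval he fun x s' hx h => hv x s' hx (.inr h))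
  | .opF c a, s, ht, hv => by
    have hc : Interpolates e s (fun i => s.through (L.tense.epsF c i))
        ((𝔸.tenseExtension e).opF c) := by
      rcases ht.1 with rfl | ⟨f, rfl⟩
      exacts [he.interpolates_tense_opF 𝔸 c, he.interpolates_opF 𝔸 f s]
    exact hc.comp he fun i => (ht.2 i).interpolates_eval he fun x s' hx h => hv x s' hx ⟨i, h⟩
  | .opG c a, s, ht, hv => by
    have hc : Interpolates e s (fun i => s.through (L.tense.epsG c i))
        ((𝔸.tenseExtension e).opG c) := by
      rcases ht.1 with rfl | ⟨g, rfl⟩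
      exacts [he.interpolates_tense_opG 𝔸 c, he.interpolates_opG 𝔸 g s]
    exact hc.comp he fun i => (ht.2 i).interpolates_eval he fun x s' hx h => hv x s' hx ⟨i, h⟩

theorem eval_mem_signedClosed (he : IsCanonicalExtension e) {t : ETerm L} (ht : t.SynClosed s)
    {v : Atom → C} (hv : Admissible e (Set.range e) v) :
    t.eval (𝔸.tenseExtension e) v ∈ signedClosed e s :=
  (ht.interpolates_eval (ι := Empty) (τ := nofun) (v := fun _ => v) he fun _ _ hx _ =>
    .const he _ (hv.mem_signedClosed hx)).mem_signedClosed he (k := nofun) nofun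

theorem interpolates_eval_update (he : IsCanonicalExtension e) {t : ETerm L}
    (ht : t.SynClosed s) {v : Atom → C} (hv : Admissible e (Set.range e) v) {p : ℕ}
    (hp : ¬ t.OccursWith (.prop p) σ.op s) :
    Interpolates e s (fun _ : Unit => σ)
      fun u => t.eval (𝔸.tenseExtension e) (update v (.prop p) (u ())) := by
  refine ht.interpolates_eval he fun x s' hx h => ?_
  rcases eq_or_ne x (.prop p) with rfl | hxp
  · obtain rfl : s' = σ := (s'.eq_or_eq_op σ).resolve_right fun hs => hp (hs ▸ h)
    simpa only [update_self] using Interpolates.apply he (fun _ : Unit => s') ()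
  · simpa only [update_of_ne hxp] using .const he _ (hv.mem_signedClosed hx)

end Term.SynClosed

end SynClosed

/-! ### Occurrences -/

section Occurrences

variable {L : Signature.{u}} {V : Type} {x : V}

namespace Term

theorem OccursWith.of_op {σ : Pol} : ∀ {t : Term L V} {s : Pol},
    t.OccursWith x σ.op s.op → t.OccursWith x σ s
  | .atom _, _, h => ⟨h.1, by simpa using congrArg Pol.op h.2⟩
  | .meet _ _, _, h => h.imp of_op of_op
  | .join _ _, _, h => h.imp of_op of_op
  | .opF _ _, _, ⟨i, h⟩ | .opG _ _, _, ⟨i, h⟩ => ⟨i, of_op (by rwa [← Pol.through_op])⟩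

/-- The term `α` of the Ackermann rules: `⋁ l` for the sign `+`, and `⋀ l` for the sign `-`. -/
def bigSup : Pol → List (Term L V) → Term L V
  | .pos => bigJoin
  | .neg => bigMeet

theorem SynClosed.bigSup {s : Pol} : ∀ {l : List (ETerm L)}, (∀ t ∈ l, t.SynClosed s) →
    (Term.bigSup s l).SynClosed s
  | [], _ => by cases s <;> trivial
  | [t], h => by cases s <;> exact h t (List.mem_singleton_self t)
  | t :: t' :: l, h => by
    rw [List.forall_mem_cons] at h
    have := bigSup h.2
    cases s <;> exact ⟨h.1, this⟩

variable {A : Type v} [Lattice A] [BoundedOrder A] {O : Ops L A}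

theorem eval_bigSup_le {s : Pol} {v : V → A} {y : A} : ∀ {l : List (Term L V)},
    s.le ((Term.bigSup s l).eval O v) y ↔ ∀ t ∈ l, s.le (t.eval O v) y
  | [] => by cases s <;> simp [Term.bigSup, bigJoin, bigMeet, eval, Pol.le]
  | [t] => by cases s <;> simp [Term.bigSup, bigJoin, bigMeet]
  | t :: t' :: l => by
    have : (Term.bigSup s (t :: t' :: l)).eval O v =
        s.sup (t.eval O v) ((Term.bigSup s (t' :: l)).eval O v) := by cases s <;> rfl
    rw [this, Pol.sup_le_iff, eval_bigSup_le, List.forall_mem_cons (a := t)]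

end Term

theorem Ctx.occurs_plug {γ : Term L V} (hx : γ.Occurs x) : ∀ D : Ctx L V, (D.plug γ).Occurs x
  | .hole => hx
  | .meetL D _ | .joinL D _ => .inl (D.occurs_plug hx)
  | .meetR _ D | .joinR _ D => .inr (D.occurs_plug hx)
  | .opF _ i _ D | .opG _ i _ D => ⟨i, by simpa using D.occurs_plug hx⟩

end Occurrences

section Inequalities

variable {L : Signature.{u}} {V : Type}

/-- The inequality `l ≤ r` for the sign `+`, and `r ≤ l` for the sign `-`. -/
def Pol.ineq : Pol → Term L V → Term L V → Ineq L V
  | .pos, l, r => ⟨l, r⟩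
  | .neg, l, r => ⟨r, l⟩

theorem Pol.occurs_ineq {s : Pol} {l r : Term L V} {x : V} :
    (s.ineq l r).Occurs x ↔ l.Occurs x ∨ r.Occurs x := by
  cases s
  exacts [Iff.rfl, or_comm]

/-- The left-hand side is syntactically closed and the right-hand side is syntactically open. -/
def Ineq.SynClosed (i : EIneq L) : Prop := i.lhs.SynClosed .pos ∧ i.rhs.SynClosed .neg

theorem Pol.synClosed_ineq {s : Pol} {l r : ETerm L} :
    (s.ineq l r).SynClosed ↔ l.SynClosed s ∧ r.SynClosed s.op := by
  cases s
  exacts [Iff.rfl, and_comm]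

variable {A : Type v} [Lattice A] [BoundedOrder A] {O : Ops L A}

theorem Pol.holds_ineq {s : Pol} {l r : Term L V} {v : V → A} :
    (s.ineq l r).Holds O v ↔ s.le (l.eval O v) (r.eval O v) := by
  cases s <;> rfl

theorem Ineq.holds_congr {i : Ineq L V} {v v' : V → A} (h : ∀ x, i.Occurs x → v x = v' x) :
    i.Holds O v ↔ i.Holds O v' := by
  rw [Ineq.Holds, Ineq.Holds, i.lhs.eval_congr fun x hx => h x (.inl hx),
    i.rhs.eval_congr fun x hx => h x (.inr hx)]

theorem Ineq.holds_update [DecidableEq V] {i : Ineq L V} {x : V} (hx : ¬ i.Occurs x)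
    (v : V → A) (c : A) : i.Holds O (update v x c) ↔ i.Holds O v :=
  holds_congr fun _ hy => update_of_ne (by rintro rfl; exact hx hy) _ _

theorem Ineq.holds_subst [DecidableEq V] (i : Ineq L V) (x : V) (r : Term L V) (v : V → A) :
    (i.subst x r).Holds O v ↔ i.Holds O (update v x (r.eval O v)) := by
  simp only [Ineq.Holds, Ineq.subst, Term.eval_subst]

theorem Ctx.eval_update_of_not_occurs [DecidableEq V] {x : V} {γ : Term L V} (D : Ctx L V)
    (hx : ¬ (D.plug γ).Occurs x) (v : V → A) (c d : A) :
    D.eval O (update v x c) d = D.eval O v d := by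
  induction D with
  | hole => rfl
  | meetL D t ih | joinL D t ih =>
    obtain ⟨hD, ht⟩ := not_or.1 hx
    simp only [eval, ih hD, Term.eval_update_of_not_occurs ht]
  | meetR t D ih | joinR t D ih =>
    obtain ⟨ht, hD⟩ := not_or.1 hx
    simp only [eval, ih hD, Term.eval_update_of_not_occurs ht]
  | opF f i a D ih | opG g i a D ih =>
    have ha : ∀ j, ¬ (update a i (D.plug γ) j).Occurs x := not_exists.1 hx
    have hD := ih (by simpa using ha i)
    simp only [eval, hD]
    congr 1
    funext j
    rcases eq_or_ne j i with rfl | hj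
    · simp only [update_self]
    · simpa only [update_of_ne hj] using
        Term.eval_update_of_not_occurs (by simpa [hj] using ha j) v c

end Inequalities

/-! ### Executions of ALBA -/

section ALBA

variable {L : Signature.{u}}

/-- Nominals for the sign `+`, co-nominals for the sign `-`: the variables that the approximation
rules introduce. -/
def Pol.marker : Pol → ℕ → Atom
  | .pos => .nom
  | .neg => .conom

/-- The approximation rules, with an arbitrary SLR branch and an arbitrary fresh variable. -/
inductive Approximation : System L → System L → Prop
  | mk (S : Finset (EIneq L)) (s : Pol) (D : Ctx L.tense Atom) (γ : BTerm L) (δ : ETerm L) (j : ℕ)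
      (hD : D.SLR s)
      (hj : ¬ System.Occurs ((D.sign s).marker j) ⟨S, s.ineq (D.plug γ.embed) δ⟩) :
      Approximation ⟨S, s.ineq (D.plug γ.embed) δ⟩
        ⟨insert ((D.sign s).ineq (.atom ((D.sign s).marker j)) γ.embed) S,
          s.ineq (D.plug (.atom ((D.sign s).marker j))) δ⟩

theorem PivotalApprox.approximation {X Y : System L} (h : PivotalApprox X Y) :
    Approximation X Y := by
  cases h with
  | leftPos S D γ ψ j hpiv hsign hj | leftNeg S D γ ψ j hpiv hsign hj =>
    have h := Approximation.mk S .pos D γ ψ j hpiv.1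
    rw [hsign] at h
    exact h hj.1
  | rightPos S D γ φ j hpiv hsign hj | rightNeg S D γ φ j hpiv hsign hj =>
    have h := Approximation.mk S .neg D γ φ j hpiv.1
    rw [hsign] at h
    exact h hj.1

/-- One step of an execution of the second stage of ALBA, in which the applications of
approximation rules need not be pivotal. -/
inductive Step : System L → System L → Prop
  | approx {X Y : System L} (h : Approximation X Y) : Step X Y
  | residuation {S : Finset (EIneq L)} {main i j : EIneq L} (hi : i ∈ S)
      (h : Residuation i j) : Step ⟨S, main⟩ ⟨insert j (S.erase i), main⟩
  | split {S T : Finset (EIneq L)} {main : EIneq L} (h : SplitStep S T) :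
      Step ⟨S, main⟩ ⟨T, main⟩
  | ackermann {X Y : System L} (h : Ackermann X Y) : Step X Y

theorem PivotalStep.step {X Y : System L} : PivotalStep X Y → Step X Y
  | .approx _ _ h => .approx h.approximation
  | .residuation _ _ _ _ hi h => .residuation hi h
  | .split _ _ _ h => .split h
  | .ackermann _ _ h => .ackermann h

/-- ALBA succeeds on the inequality `i`: some execution, which need be neither pivotal nor
exhaustive in the preprocessing, ends with pure systems. -/
def ALBASucceeds (i : BIneq L) : Prop :=
  ∃ (i₁ i₂ : BIneq L) (I : Finset (BIneq L)), Relation.ReflTransGen ElimStep i i₁ ∧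
    Relation.ReflTransGen DistStep i₁ i₂ ∧ Relation.ReflTransGen SplitStep {i₂} I ∧
    ∀ k ∈ I, ∃ Y : System L, Relation.ReflTransGen Step ⟨∅, k.embed⟩ Y ∧ Y.Pure

theorem ALBASucceedsPivotally.albaSucceeds {i : BIneq L} :
    ALBASucceedsPivotally i → ALBASucceeds i
  | ⟨I, ⟨i₁, i₂, h₁, h₂, h₃⟩, h⟩ => ⟨i₁, i₂, I, h₁.1, h₂.1, h₃.1, fun k hk =>
    (h k hk).imp fun _ hY =>
      ⟨Relation.ReflTransGen.mono (fun _ _ => PivotalStep.step) _ _ hY.1, hY.2⟩⟩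

end ALBA

/-! ### Soundness of the rules -/

section Soundness

variable {L : Signature.{u}} {A : Type v} {C : Type w} [Lattice A] [BoundedOrder A]
  [CompleteLattice C] {𝔸 : LatticeExpansion L A} {e : BoundedLatticeHom A C} {P : Set C}

theorem Admissible.update_prop {v : Atom → C} (hv : Admissible e P v) (p : ℕ) {c : C}
    (hc : c ∈ P) : Admissible e P (update v (.prop p) c) where
  prop q := by
    rcases eq_or_ne q p with rfl | hq
    · simpa using hc
    · simpa [hq] using hv.prop q
  nom j := by simpa using hv.nom j
  conom m := by simpa using hv.conom m

theorem Admissible.update_marker {v : Atom → C} (hv : Admissible e P v) {s : Pol} (j : ℕ) {c : C}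
    (hc : c ∈ signedClosed e s) : Admissible e P (update v (s.marker j) c) where
  prop p := by
    rw [update_of_ne (by cases s <;> simp [Pol.marker])]
    exact hv.prop p
  nom k := by
    by_cases h : Atom.nom k = s.marker j
    · cases s
      · rwa [h, update_self]
      · cases h
    · rw [update_of_ne h]
      exact hv.nom k
  conom k := by
    by_cases h : Atom.conom k = s.marker j
    · cases s
      · cases h
      · rwa [h, update_self]
    · rw [update_of_ne h]
      exact hv.conom k

/-- Validity of a system as a quasi-inequality, for the assignments of elements of `P` to the
proposition letters. -/
def System.Valid (O : Ops L.tense C) (e : BoundedLatticeHom A C) (P : Set C) (X : System L) :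
    Prop :=
  ∀ v, Admissible e P v → (∀ i ∈ X.S, i.Holds O v) → X.main.Holds O v

/-- The inequalities in `S` are syntactically closed; this invariant is what makes the Ackermann
rules sound for assignments in `A`. -/
def System.SynClosed (X : System L) : Prop := ∀ i ∈ X.S, i.SynClosed

/-- The step from `X` to `Y` preserves syntactic closedness and validity for assignments in `A`,
and it reflects validity for assignments in the canonical extension. -/
structure SoundStep (𝔸 : LatticeExpansion L A) (e : BoundedLatticeHom A C) (X Y : System L) :
    Prop where
  synClosed : X.SynClosed → Y.SynClosed
  valid : X.SynClosed → X.Valid (𝔸.tenseExtension e) e (Set.range e) →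
    Y.Valid (𝔸.tenseExtension e) e (Set.range e)
  valid_of_valid : Y.Valid (𝔸.tenseExtension e) e Set.univ →
    X.Valid (𝔸.tenseExtension e) e Set.univ

namespace SoundStep

variable {X Y Z : System L}

theorem refl (X : System L) : SoundStep 𝔸 e X X := ⟨id, fun _ => id, id⟩

theorem trans (h : SoundStep 𝔸 e X Y) (h' : SoundStep 𝔸 e Y Z) : SoundStep 𝔸 e X Z where
  synClosed := h'.synClosed ∘ h.synClosed
  valid hX := h'.valid (h.synClosed hX) ∘ h.valid hX
  valid_of_valid := h.valid_of_valid ∘ h'.valid_of_valid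

theorem of_forall_holds_iff {S T : Finset (EIneq L)} {main : EIneq L}
    (hsyn : System.SynClosed ⟨S, main⟩ → System.SynClosed ⟨T, main⟩)
    (h : ∀ v, (∀ i ∈ S, i.Holds (𝔸.tenseExtension e) v) ↔
      ∀ i ∈ T, i.Holds (𝔸.tenseExtension e) v) :
    SoundStep 𝔸 e ⟨S, main⟩ ⟨T, main⟩ :=
  ⟨hsyn, fun _ hX v hv hT => hX v hv ((h v).2 hT), fun hY v hv hS => hY v hv ((h v).1 hS)⟩

end SoundStep

theorem SplitStep.synClosed {S T : Finset (EIneq L)} (h : SplitStep S T) {main : EIneq L}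
    (hS : System.SynClosed ⟨S, main⟩) : System.SynClosed ⟨T, main⟩ := by
  obtain ⟨i, j, k, hi, hijk⟩ := h
  have hjk : j.SynClosed ∧ k.SynClosed := by
    have ⟨hl, hr⟩ := hS i hi
    cases hijk with
    | meet α β γ => exact ⟨⟨hl, hr.1⟩, ⟨hl, hr.2⟩⟩
    | join α β γ => exact ⟨⟨hl.1, hr⟩, ⟨hl.2, hr⟩⟩
  simp only [System.SynClosed, Finset.forall_mem_insert]
  exact ⟨hjk.1, hjk.2, fun x hx => hS x (Finset.mem_of_mem_erase hx)⟩

theorem synClosed_update_residualType {n : ℕ} {ε : Fin n → Pol} {s t : Pol} {i : Fin n}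
    (h : (s.through (ε i)).op = t) {φ : Fin n → ETerm L} {ψ : ETerm L}
    (hφ : ∀ j, (φ j).SynClosed (s.through (ε j))) (hψ : ψ.SynClosed s.op) (j : Fin n) :
    (update φ i ψ j).SynClosed (t.through (residualType ε i j)) := by
  rw [congrFun (through_residualType h) j]
  rcases eq_or_ne j i with rfl | hj
  · simpa using hψ
  · simpa [hj] using hφ j

theorem Residuation.synClosed {i j : EIneq L} (h : Residuation i j) (hi : i.SynClosed) :
    j.SynClosed := by
  cases h with
  | fPos f i h φ ψ =>
    obtain ⟨⟨-, hφ⟩, hψ⟩ := hi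
    exact ⟨by simpa [h] using hφ i, .inl rfl,
      synClosed_update_residualType (s := .pos) (by rw [h]; rfl) hφ hψ⟩
  | fNeg f i h φ ψ =>
    obtain ⟨⟨-, hφ⟩, hψ⟩ := hi
    exact ⟨⟨.inl rfl, synClosed_update_residualType (s := .pos) (by rw [h]; rfl) hφ hψ⟩,
      by simpa [h] using hφ i⟩
  | gPos g i h φ ψ =>
    obtain ⟨hψ, ⟨-, hφ⟩⟩ := hi
    exact ⟨⟨.inl rfl, synClosed_update_residualType (s := .neg) (by rw [h]; rfl) hφ hψ⟩,
      by simpa [h, Pol.op] using hφ i⟩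
  | gNeg g i h φ ψ =>
    obtain ⟨hψ, ⟨-, hφ⟩⟩ := hi
    exact ⟨by simpa [h, Pol.op] using hφ i, .inl rfl,
      synClosed_update_residualType (s := .neg) (by rw [h]; rfl) hφ hψ⟩

theorem Residuation.holds_iff (he : IsCanonicalExtension e) {i j : EIneq L} (h : Residuation i j)
    (v : Atom → C) : i.Holds (𝔸.tenseExtension e) v ↔ j.Holds (𝔸.tenseExtension e) v := by
  cases h with
  | fPos f i h φ ψ | fNeg f i h φ ψ =>
    have hf := (he.isCompleteOperator_opF 𝔸 f).le_iff_le_residual (i := i)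
      (u := fun j => (φ j).eval (𝔸.tenseExtension e) v) (y := ψ.eval (𝔸.tenseExtension e) v)
    rw [h] at hf
    simp only [Ineq.Holds, Term.eval, Term.eval_update_args]
    exact hf
  | gPos g i h φ ψ | gNeg g i h φ ψ =>
    have hg := (he.isCompleteOperator_opG 𝔸 g).le_iff_le_residual (i := i)
      (u := fun j => (φ j).eval (𝔸.tenseExtension e) v) (y := ψ.eval (𝔸.tenseExtension e) v)
    rw [h] at hg
    simp only [Ineq.Holds, Term.eval, Term.eval_update_args]
    exact hg


/-- The connectives along the branch are residuated, which reduces the claim to the hole. -/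
theorem Ctx.SLR.le_of_forall_closed (he : IsCanonicalExtension e) (v : Atom → C) {x : C} :
    ∀ {D : Ctx L.tense Atom} {s : Pol} {y : C}, D.SLR s →
      (∀ c ∈ signedClosed e (D.sign s), (D.sign s).le c x →
        s.le (D.eval (𝔸.tenseExtension e) v c) y) →
      s.le (D.eval (𝔸.tenseExtension e) v x) y
  | .hole, _, _, _, h => he.le_of_forall_closed h
  | .opF c i a D, _, y, ⟨rfl, hD⟩, h => by
    have hc := fun d => (he.isCompleteOperator_tense_opF 𝔸 c).le_iff_le_residual (i := i) (y := y)
      (u := update (fun j => (a j).eval (𝔸.tenseExtension e) v) i d)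
    simp only [update_self, update_idem] at hc
    exact (hc _).2 (hD.le_of_forall_closed he v fun d hd hdx => (hc _).1 (h d hd hdx))
  | .opG c i a D, _, y, ⟨rfl, hD⟩, h => by
    have hc := fun d => (he.isCompleteOperator_tense_opG 𝔸 c).le_iff_le_residual (i := i) (y := y)
      (u := update (fun j => (a j).eval (𝔸.tenseExtension e) v) i d)
    simp only [update_self, update_idem] at hc
    exact (hc _).2 (hD.le_of_forall_closed he v fun d hd hdx => (hc _).1 (h d hd hdx))

theorem Approximation.soundStep (he : IsCanonicalExtension e) {X Y : System L}
    (h : Approximation X Y) : SoundStep 𝔸 e X Y := by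
  obtain ⟨S, s, D, γ, δ, j, hD, hj⟩ := h
  set t := D.sign s
  obtain ⟨hjS, hjmain⟩ := not_or.1 hj
  obtain ⟨hjD, hjδ⟩ := not_or.1 (Pol.occurs_ineq.not.1 hjmain)
  refine ⟨fun hX => ?_, fun _ hX v hv hY => ?_, fun hY v hv hX => ?_⟩
  · simp only [System.SynClosed, Finset.forall_mem_insert]
    exact ⟨Pol.synClosed_ineq.2 ⟨by cases t <;> rfl, γ.synClosed_embed _⟩, hX⟩
  · obtain ⟨hjγ, hS⟩ := (Finset.forall_mem_insert _ _ _).1 hY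
    have hmain := Pol.holds_ineq.1 (hX v hv hS)
    refine Pol.holds_ineq.2 (Pol.le_trans ?_ hmain)
    rw [Ctx.eval_plug, Ctx.eval_plug]
    exact hD.eval_mono (he.tenseExtension_isNormal 𝔸) v (Pol.holds_ineq.1 hjγ)
  · refine Pol.holds_ineq.2 ?_
    rw [Ctx.eval_plug]
    refine hD.le_of_forall_closed he v fun c hc hcγ => ?_
    have hmain := Pol.holds_ineq.1 <| hY _ (hv.update_marker j hc) <|
      (Finset.forall_mem_insert _ _ _).2 ⟨?_, fun i hi => ?_⟩
    · rwa [Ctx.eval_plug, D.eval_update_of_not_occurs hjD, Term.eval_update_of_not_occurs hjδ,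
        Term.eval, update_self] at hmain
    · rw [Pol.holds_ineq, Term.eval, update_self,
        Term.eval_update_of_not_occurs fun h => hjD (D.occurs_plug h)]
      exact hcγ
    · exact (Ineq.holds_update (fun h => hjS ⟨i, hi, h⟩) v c).2 (hX i hi)

section Ackermann

variable {σ : Pol} {p : ℕ} {α : ETerm L} {R : Finset (EIneq L)} {main : EIneq L} {i : EIneq L}

theorem Ineq.SynClosed.subst (hi : i.SynClosed) (hα : α.SynClosed σ)
    (hl : ¬ i.lhs.OccursWith (.prop p) σ.op .pos) (hr : ¬ i.rhs.OccursWith (.prop p) σ .pos) :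
    (i.subst (.prop p) α).SynClosed :=
  ⟨hα.subst hi.1 hl, hα.subst hi.2 fun h => hr (.of_op h)⟩

theorem Ineq.Holds.update_of_le {A : Type v} [Lattice A] [BoundedOrder A] {O : Ops L.tense A}
    (hO : O.IsNormal) {v : Atom → A} {x : Atom} {c : A} (hi : i.Holds O v) (hc : σ.le c (v x))
    (hl : ¬ i.lhs.OccursWith x σ.op .pos) (hr : ¬ i.rhs.OccursWith x σ .pos) :
    i.Holds O (update v x c) := by
  have hlv := i.lhs.eval_update_le_eval_update hO v hc .pos hl
  have hrv := i.rhs.eval_update_le_eval_update hO v hc .neg fun h => hr (.of_op h)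
  rw [update_eq_self] at hlv hrv
  exact hlv.trans (hi.trans hrv)

/-- Compactness replaces the closed value of `p` by an element of `A`. -/
theorem Admissible.exists_forall_holds_update (he : IsCanonicalExtension e) {v : Atom → C}
    (hv : Admissible e (Set.range e) v) {c : C} (hc : c ∈ signedClosed e σ)
    (hR : ∀ i ∈ R, i.SynClosed) (hl : ∀ i ∈ R, ¬ i.lhs.OccursWith (.prop p) σ.op .pos)
    (hr : ∀ i ∈ R, ¬ i.rhs.OccursWith (.prop p) σ .pos)
    (h : ∀ i ∈ R, i.Holds (𝔸.tenseExtension e) (update v (.prop p) c)) :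
    ∃ a, σ.le c (e a) ∧
      ∀ i ∈ R, i.Holds (𝔸.tenseExtension e) (update v (.prop p) (e a)) := by
  obtain ⟨a, hca, ha⟩ := Interpolates.exists_forall_le (κ := R) (s := .pos) he
    (fun i => (hR i i.2).1.interpolates_eval_update (𝔸 := 𝔸) he hv (hl i i.2))
    (fun i => (hR i i.2).2.interpolates_eval_update he hv fun h => hr i i.2 (.of_op h))
    (k := fun _ => c) (fun _ => hc) fun i => h i i.2
  exact ⟨a (), hca (), fun i hi => ha ⟨i, hi⟩⟩

/-- Both Ackermann rules: the right one for the sign `+`, the left one for the sign `-`. -/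
theorem SoundStep.ackermann (he : IsCanonicalExtension e) {αs : List (ETerm L)}
    (hα : ∀ α ∈ αs, ¬ α.Occurs (.prop p)) (hmain : ¬ main.Occurs (.prop p))
    (hl : ∀ i ∈ R, ¬ i.lhs.OccursWith (.prop p) σ.op .pos)
    (hr : ∀ i ∈ R, ¬ i.rhs.OccursWith (.prop p) σ .pos) :
    SoundStep 𝔸 e ⟨(αs.map fun α => σ.ineq α (.atom (.prop p))).toFinset ∪ R, main⟩
      ⟨R.image fun i => i.subst (.prop p) (Term.bigSup σ αs), main⟩ := by
  have forall_mem {Q : EIneq L → Prop} :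
      (∀ i ∈ (αs.map fun α => σ.ineq α (.atom (.prop p))).toFinset ∪ R, Q i) ↔
        (∀ α ∈ αs, Q (σ.ineq α (.atom (.prop p)))) ∧ ∀ i ∈ R, Q i := by
    simp only [Finset.mem_union, List.mem_toFinset, or_imp, forall_and, List.forall_mem_map]
  have hsyn (hX : System.SynClosed ⟨_ ∪ R, main⟩) := forall_mem.1 hX
  have hbigSyn (hX : System.SynClosed ⟨_ ∪ R, main⟩) : (Term.bigSup σ αs).SynClosed σ :=
    .bigSup fun α hα => (Pol.synClosed_ineq.1 ((hsyn hX).1 α hα)).1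
  refine ⟨fun hX => ?_, fun hX hvalid v hv hY => ?_, fun hvalid v hv hX => ?_⟩
  · refine Finset.forall_mem_image.2 fun i hi => ?_
    exact ((hsyn hX).2 i hi).subst (hbigSyn hX) (hl i hi) (hr i hi)
  · obtain ⟨a, hca, ha⟩ := hv.exists_forall_holds_update he
      ((hbigSyn hX).eval_mem_signedClosed he hv) (hsyn hX).2 hl hr fun i hi =>
        (i.holds_subst _ _ v).1 (hY _ (Finset.mem_image_of_mem _ hi))
    refine (Ineq.holds_update hmain v (e a)).1 (hvalid _ (hv.update_prop p ⟨a, rfl⟩) ?_)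
    refine forall_mem.2 ⟨fun α hα' => ?_, ha⟩
    rw [Pol.holds_ineq, Term.eval_update_of_not_occurs (hα α hα'), Term.eval, update_self]
    exact Term.eval_bigSup_le.1 hca α hα'
  · obtain ⟨hT, hR⟩ := forall_mem.1 hX
    refine hvalid v hv (Finset.forall_mem_image.2 fun i hi => ?_)
    rw [Ineq.holds_subst]
    exact (hR i hi).update_of_le (he.tenseExtension_isNormal 𝔸)
      (Term.eval_bigSup_le.2 fun α hα' => Pol.holds_ineq.1 (hT α hα')) (hl i hi) (hr i hi)

end Ackermann

theorem Ackermann.soundStep (he : IsCanonicalExtension e) {X Y : System L} :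
    Ackermann X Y → SoundStep 𝔸 e X Y
  | .right _ _ _ _ hα hmain hβ hγ => .ackermann (σ := .pos) he hα hmain hβ hγ
  | .left _ _ _ _ hα hmain hβ hγ => .ackermann (σ := .neg) he hα hmain hβ hγ

theorem Step.soundStep (he : IsCanonicalExtension e) {X Y : System L} (h : Step X Y) :
    SoundStep 𝔸 e X Y := by
  cases h with
  | approx h => exact h.soundStep he
  | residuation hi h =>
    refine .of_forall_holds_iff (fun hS => ?_) fun v => ?_
    · simp only [System.SynClosed, Finset.forall_mem_insert]
      exact ⟨h.synClosed (hS _ hi), fun k hk => hS k (Finset.mem_of_mem_erase hk)⟩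
    · conv_lhs => rw [← Finset.insert_erase hi]
      simp only [Finset.forall_mem_insert, h.holds_iff he]
  | split h => exact .of_forall_holds_iff h.synClosed h.forall_holds_iff
  | ackermann h => exact h.soundStep he

theorem SoundStep.of_reflTransGen (he : IsCanonicalExtension e) {X Y : System L}
    (h : Relation.ReflTransGen Step X Y) : SoundStep 𝔸 e X Y := by
  induction h with
  | refl => exact .refl X
  | tail _ h ih => exact ih.trans (h.soundStep he)

theorem System.Pure.valid_univ {O : Ops L.tense C} {Y : System L} (hY : Y.Pure)
    (h : Y.Valid O e (Set.range e)) : Y.Valid O e Set.univ := by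
  intro v hv hS
  let v' : Atom → C
    | .prop _ => e ⊥
    | x => v x
  have hv' : Admissible e (Set.range e) v' := ⟨fun _ => ⟨⊥, rfl⟩, hv.nom, hv.conom⟩
  have hvv' : ∀ x, Y.Occurs x → v x = v' x
    | .prop p, hx => absurd hx (hY p)
    | .nom _, _ | .conom _, _ => rfl
  exact (Ineq.holds_congr fun x hx => hvv' x (.inr hx)).2 (h v' hv' fun i hi =>
    (Ineq.holds_congr fun x hx => hvv' x (.inl ⟨i, hi, hx⟩)).1 (hS i hi))

theorem IsCanonicalExtension.valid_of_reflTransGen (he : IsCanonicalExtension e) {k : BIneq L}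
    {Y : System L} (h : Relation.ReflTransGen Step ⟨∅, k.embed⟩ Y) (hY : Y.Pure)
    (hk : 𝔸.toOps.Valid k) : (𝔸.canonicalExtension e).Valid k := by
  have hstep : SoundStep 𝔸 e ⟨∅, k.embed⟩ Y := .of_reflTransGen he h
  have hrange : System.Valid (𝔸.tenseExtension e) e (Set.range e) ⟨∅, k.embed⟩ := by
    intro v hv _
    choose a ha using hv.prop
    simp only [Ineq.Holds, Ineq.embed, Term.eval_embed, ← ha, he.eval_canonicalExtension]
    exact OrderHomClass.mono e (hk a)
  have huniv := hstep.valid_of_valid <| hY.valid_univ <|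
    hstep.valid (fun _ h => absurd h (Finset.notMem_empty _)) hrange
  intro v
  let v' : Atom → C
    | .prop p => v p
    | .nom _ | .conom _ => e ⊥
  have hv' : Admissible e Set.univ v' := ⟨fun _ => trivial,
    fun _ => map_mem_signedClosed e .pos ⊥, fun _ => map_mem_signedClosed e .neg ⊥⟩
  simpa only [Ineq.Holds, Ineq.embed, Term.eval_embed] using
    huniv v' hv' fun _ h => absurd h (Finset.notMem_empty _)

end Soundness

end LatExp

theorem mainTheorem2_general (L : LatExp.Signature.{u}) (φ ψ : LatExp.BTerm L)
    (hsucc : LatExp.ALBASucceeds ⟨φ, ψ⟩)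
    (A : Type v) [Lattice A] [BoundedOrder A] (𝔸 : LatExp.LatticeExpansion L A)
    (C : Type w) [CompleteLattice C] (e : BoundedLatticeHom A C)
    (he : LatExp.IsCanonicalExtension e)
    (hvalid : 𝔸.toOps.Valid ⟨φ, ψ⟩) :
    (𝔸.canonicalExtension e).Valid ⟨φ, ψ⟩ := by
  obtain ⟨i₁, i₂, I, hElim, hDist, hSplit, hI⟩ := hsucc
  rw [LatExp.valid_iff_of_preprocessing (he.canonicalExtension_isNormal 𝔸) hElim hDist hSplit]
  rw [LatExp.valid_iff_of_preprocessing 𝔸.isNormal hElim hDist hSplit] at hvalid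
  intro k hk
  obtain ⟨Y, hY, hpure⟩ := hI k hk
  exact he.valid_of_reflTransGen hY hpure (hvalid k hk)

theorem mainTheorem2 (L : LatExp.Signature.{u}) (φ ψ : LatExp.BTerm L)
    (hsucc : LatExp.ALBASucceedsPivotally ⟨φ, ψ⟩)
    (A : Type v) [Lattice A] [BoundedOrder A] (𝔸 : LatExp.LatticeExpansion L A)
    (C : Type w) [CompleteLattice C] (e : BoundedLatticeHom A C)
    (he : LatExp.IsCanonicalExtension e)
    (hvalid : 𝔸.toOps.Valid ⟨φ, ψ⟩) :
    (𝔸.canonicalExtension e).Valid ⟨φ, ψ⟩ :=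
  mainTheorem2_general L φ ψ hsucc.albaSucceeds A 𝔸 C e he hvalid
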